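/- Let $\mathbf{A}$ and $\mathbf{X}$ be elementary topoi (categories with finite limits that are cartesian closed and have a subobject classifier), and let $L \colon \mathbf{A} \rightleftarrows \mathbf{X} \colon R$ be an adjunction, $L \dashv R$, with $L$ preserving pullbacks. A *structured cospan* from $a$ to $b$ is a cospan $La \to x \leftarrow Lb$ in $\mathbf{X}$. A *fine rewrite* from $La \to x \leftarrow La'$ to $Lc \to z \leftarrow Lc'$ is an isomorphism class of data consisting of spans of isomorphisms $a \xleftarrow{\cong} b \xrightarrow{\cong} c$ and $a' \xleftarrow{\cong} b' \xrightarrow{\cong} c'$ in $\mathbf{A}$, a structured cospan $Lb \to y \leftarrow Lb'$, and monomorphisms $y \rightarrowtail x$, $y \rightarrowtail z$ such that the four squares formed with the images under $L$ of the two spans commute. An isomorphism of such data (with fixed top and bottom cospans) consists of isomorphisms of the objects $b$, $b'$ and $y$ that commute with all the arrows. The *vertical composite* of two fine rewrites with middle rows $Lb \to w \leftarrow Lb'$ and $Ld \to y \leftarrow Ld'$, the bottom cospan $Lc \to x \leftarrow Lc'$ of the first being the top cospan of the second, has middle row $L(b\times_c d) \to w\times_x y \leftarrow L(b'\times_{c'}d')$.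 Structured cospans $La \to v \leftarrow La'$ and $La' \to v' \leftarrow La''$ are composed by pushout, giving $La \to v+_{La'}v' \leftarrow La''$. The *horizontal composite* of two fine rewrites which share a vertical edge (as an isomorphism class of spans) has top, middle and bottom rows given by the pushouts of the respective rows, for instance the middle row $Lb \to w+_{Lb'}w' \leftarrow Lb''$. Then $\mathbf{X}$ has pushouts, horizontal and vertical composites of fine rewrites are again fine rewrites, and the following forms a pseudo double category ${}_L\mathbb{F}\mathbf{ineRewrite}$: * objects: the objects of $\mathbf{A}$; * vertical arrows $a \to c$: isomorphism classes of spans $a \xleftarrow{\cong} b \xrightarrow{\cong} c$ in $\mathbf{A}$ with both legs invertible, composed by pullback; * horizontal arrows from $a$ to $b$: structured cospans $La \to x \leftarrow Lb$, composed by pushout, with units $La = La = La$; * squares: fine rewrites, with the above vertical and horizontal compositions; the left and right vertical edges of a square are the classes of its two outer spans, and the unit square on the class of $a \leftarrow b \to c$ has rows $La = La = La$, $Lb = Lb = Lb$ and $Lc = Lc = Lc$; * associators and unitors: the globular squares given by the canonical isomorphisms $(x+_{Lb}y)+_{Lc}z \cong x+_{Lb}(y+_{Lc}z)$, $La+_{La}x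 \cong x$ and $x+_{Lb}Lb \cong x$. In particular the interchange law holds: for fine rewrites $\alpha,\alpha',\beta,\beta'$ for which the composites are defined, $$(\alpha \circ_{\mathrm h} \alpha') \circ_{\mathrm v} (\beta \circ_{\mathrm h} \beta') = (\alpha \circ_{\mathrm v} \beta) \circ_{\mathrm h} (\alpha' \circ_{\mathrm v} \beta').$$ -/

import Mathlib

open CategoryTheory CategoryTheory.Limits

universe v₁ v₂ u₁ u₂ w₀ w₁ w₂ w₃

noncomputable section

/-! ## Pseudo double categories -/

/-- The data of a pseudo double category: an object category (objects `Obj`, vertical arrows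
`Ver`), an arrow category (objects: the horizontal arrows; arrows: the squares), source, target,
unit and horizontal composition on objects and on arrows, associators and unitors.
Horizontal arrows are indexed by their source and target, so the equations
`S (U a) = a = T (U a)`, `S (m ⊙ n) = S m`, `T (m ⊙ n) = T n` hold on objects by typing.
Compositions are written in diagrammatic order. -/
structure DoubleCategoryData where
  Obj : Type w₀
  /-- vertical arrows -/
  Ver : Obj → Obj → Type w₁
  /-- horizontal arrows -/
  Hor : Obj → Obj → Type w₂
  /-- squares with top edge `m` and bottom edge `n` -/
  Sq : {a b c d : Obj} → Hor a b → Hor c d → Type w₃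
  verId : (a : Obj) → Ver a a
  verComp : {a b c : Obj} → Ver a b → Ver b c → Ver a c
  /-- the left vertical edge of a square (the functor `S` on arrows) -/
  left : {a b c d : Obj} → {m : Hor a b} → {n : Hor c d} → Sq m n → Ver a c
  /-- the right vertical edge of a square (the functor `T` on arrows) -/
  right : {a b c d : Obj} → {m : Hor a b} → {n : Hor c d} → Sq m n → Ver b d
  sqId : {a b : Obj} → (m : Hor a b) → Sq m m
  /-- vertical composition of squares -/
  sqComp : {a b c d e f : Obj} → {m : Hor a b} → {n : Hor c d} → {p : Hor e f} →
    Sq m n → Sq n p → Sq m p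
  unit : (a : Obj) → Hor a a
  unitSq : {a b : Obj} → Ver a b → Sq (unit a) (unit b)
  horComp : {a b c : Obj} → Hor a b → Hor b c → Hor a c
  /-- horizontal composition of squares that share a vertical edge -/
  horCompSq : {a b c a' b' c' : Obj} → {m : Hor a b} → {n : Hor a' b'} → {m' : Hor b c} →
    {n' : Hor b' c'} → (q : Sq m n) → (q' : Sq m' n') → right q = left q' →
    Sq (horComp m m') (horComp n n')
  assoc : {a b c d : Obj} → (m : Hor a b) → (n : Hor b c) → (p : Hor c d) →
    Sq (horComp (horComp m n) p) (horComp m (horComp n p))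
  leftUnitor : {a b : Obj} → (m : Hor a b) → Sq (horComp (unit a) m) m
  rightUnitor : {a b : Obj} → (m : Hor a b) → Sq (horComp m (unit b)) m

namespace DoubleCategoryData

/-- A square that is invertible for vertical composition. -/
def IsInvertible (D : DoubleCategoryData.{w₀, w₁, w₂, w₃}) {a b c d : D.Obj} {m : D.Hor a b}
    {n : D.Hor c d} (q : D.Sq m n) : Prop :=
  ∃ r : D.Sq n m, D.sqComp q r = D.sqId m ∧ D.sqComp r q = D.sqId n

end DoubleCategoryData

/-- The axioms of a pseudo double category. Where a horizontal composite of squares occurs, the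
equation is required for every proof `h` that the two squares share the vertical edge; such
proofs always exist by the earlier axioms wherever the edges are forced to agree. -/
structure IsPseudoDoubleCategory (D : DoubleCategoryData.{w₀, w₁, w₂, w₃}) : Prop where
  -- the object category
  ver_id_comp : ∀ {a b : D.Obj} (f : D.Ver a b), D.verComp (D.verId a) f = f
  ver_comp_id : ∀ {a b : D.Obj} (f : D.Ver a b), D.verComp f (D.verId b) = f
  ver_assoc : ∀ {a b c d : D.Obj} (f : D.Ver a b) (g : D.Ver b c) (h : D.Ver c d),
    D.verComp (D.verComp f g) h = D.verComp f (D.verComp g h)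
  -- the arrow category
  sq_id_comp : ∀ {a b c d : D.Obj} {m : D.Hor a b} {n : D.Hor c d} (q : D.Sq m n),
    D.sqComp (D.sqId m) q = q
  sq_comp_id : ∀ {a b c d : D.Obj} {m : D.Hor a b} {n : D.Hor c d} (q : D.Sq m n),
    D.sqComp q (D.sqId n) = q
  sq_assoc : ∀ {a b c d a' b' c' d' : D.Obj} {m : D.Hor a b} {n : D.Hor c d}
    {p : D.Hor a' b'} {o : D.Hor c' d'} (q : D.Sq m n) (r : D.Sq n p) (s : D.Sq p o),
    D.sqComp (D.sqComp q r) s = D.sqComp q (D.sqComp r s)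
  -- source and target are functors
  left_id : ∀ {a b : D.Obj} (m : D.Hor a b), D.left (D.sqId m) = D.verId a
  right_id : ∀ {a b : D.Obj} (m : D.Hor a b), D.right (D.sqId m) = D.verId b
  left_comp : ∀ {a b c d e f : D.Obj} {m : D.Hor a b} {n : D.Hor c d} {p : D.Hor e f}
    (q : D.Sq m n) (r : D.Sq n p), D.left (D.sqComp q r) = D.verComp (D.left q) (D.left r)
  right_comp : ∀ {a b c d e f : D.Obj} {m : D.Hor a b} {n : D.Hor c d} {p : D.Hor e f}
    (q : D.Sq m n) (r : D.Sq n p), D.right (D.sqComp q r) = D.verComp (D.right q) (D.right r)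
  -- the unit is a functor, a section of source and target
  unit_id : ∀ a : D.Obj, D.unitSq (D.verId a) = D.sqId (D.unit a)
  unit_comp : ∀ {a b c : D.Obj} (f : D.Ver a b) (g : D.Ver b c),
    D.unitSq (D.verComp f g) = D.sqComp (D.unitSq f) (D.unitSq g)
  left_unit : ∀ {a b : D.Obj} (f : D.Ver a b), D.left (D.unitSq f) = f
  right_unit : ∀ {a b : D.Obj} (f : D.Ver a b), D.right (D.unitSq f) = f
  -- horizontal composition is compatible with source and target
  left_horComp : ∀ {a b c a' b' c' : D.Obj} {m : D.Hor a b} {n : D.Hor a' b'} {m' : D.Hor b c}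
    {n' : D.Hor b' c'} (q : D.Sq m n) (q' : D.Sq m' n') (h : D.right q = D.left q'),
    D.left (D.horCompSq q q' h) = D.left q
  right_horComp : ∀ {a b c a' b' c' : D.Obj} {m : D.Hor a b} {n : D.Hor a' b'} {m' : D.Hor b c}
    {n' : D.Hor b' c'} (q : D.Sq m n) (q' : D.Sq m' n') (h : D.right q = D.left q'),
    D.right (D.horCompSq q q' h) = D.right q'
  -- horizontal composition is a functor: identities, and the interchange law
  horComp_id : ∀ {a b c : D.Obj} (m : D.Hor a b) (m' : D.Hor b c)
    (h : D.right (D.sqId m) = D.left (D.sqId m')),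
    D.horCompSq (D.sqId m) (D.sqId m') h = D.sqId (D.horComp m m')
  interchange : ∀ {a b c a' b' c' a'' b'' c'' : D.Obj} {m : D.Hor a b} {m' : D.Hor b c}
    {n : D.Hor a' b'} {n' : D.Hor b' c'} {p : D.Hor a'' b''} {p' : D.Hor b'' c''}
    (q : D.Sq m n) (q' : D.Sq m' n') (r : D.Sq n p) (r' : D.Sq n' p')
    (hq : D.right q = D.left q') (hr : D.right r = D.left r')
    (h : D.right (D.sqComp q r) = D.left (D.sqComp q' r')),
    D.sqComp (D.horCompSq q q' hq) (D.horCompSq r r' hr) =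
      D.horCompSq (D.sqComp q r) (D.sqComp q' r') h
  -- associators and unitors are invertible and globular
  assoc_invertible : ∀ {a b c d : D.Obj} (m : D.Hor a b) (n : D.Hor b c) (p : D.Hor c d),
    D.IsInvertible (D.assoc m n p)
  left_assoc : ∀ {a b c d : D.Obj} (m : D.Hor a b) (n : D.Hor b c) (p : D.Hor c d),
    D.left (D.assoc m n p) = D.verId a
  right_assoc : ∀ {a b c d : D.Obj} (m : D.Hor a b) (n : D.Hor b c) (p : D.Hor c d),
    D.right (D.assoc m n p) = D.verId d
  leftUnitor_invertible : ∀ {a b : D.Obj} (m : D.Hor a b), D.IsInvertible (D.leftUnitor m)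
  left_leftUnitor : ∀ {a b : D.Obj} (m : D.Hor a b), D.left (D.leftUnitor m) = D.verId a
  right_leftUnitor : ∀ {a b : D.Obj} (m : D.Hor a b), D.right (D.leftUnitor m) = D.verId b
  rightUnitor_invertible : ∀ {a b : D.Obj} (m : D.Hor a b), D.IsInvertible (D.rightUnitor m)
  left_rightUnitor : ∀ {a b : D.Obj} (m : D.Hor a b), D.left (D.rightUnitor m) = D.verId a
  right_rightUnitor : ∀ {a b : D.Obj} (m : D.Hor a b), D.right (D.rightUnitor m) = D.verId b
  -- associators and unitors are natural
  assoc_natural : ∀ {a b c d a' b' c' d' : D.Obj} {m : D.Hor a b} {n : D.Hor b c}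
    {p : D.Hor c d} {m' : D.Hor a' b'} {n' : D.Hor b' c'} {p' : D.Hor c' d'}
    (q : D.Sq m m') (r : D.Sq n n') (s : D.Sq p p')
    (h₁ : D.right q = D.left r) (h₂ : D.right (D.horCompSq q r h₁) = D.left s)
    (h₃ : D.right r = D.left s) (h₄ : D.right q = D.left (D.horCompSq r s h₃)),
    D.sqComp (D.horCompSq (D.horCompSq q r h₁) s h₂) (D.assoc m' n' p') =
      D.sqComp (D.assoc m n p) (D.horCompSq q (D.horCompSq r s h₃) h₄)
  leftUnitor_natural : ∀ {a b c d : D.Obj} {m : D.Hor a b} {n : D.Hor c d} (q : D.Sq m n)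
    (h : D.right (D.unitSq (D.left q)) = D.left q),
    D.sqComp (D.horCompSq (D.unitSq (D.left q)) q h) (D.leftUnitor n) =
      D.sqComp (D.leftUnitor m) q
  rightUnitor_natural : ∀ {a b c d : D.Obj} {m : D.Hor a b} {n : D.Hor c d} (q : D.Sq m n)
    (h : D.right q = D.left (D.unitSq (D.right q))),
    D.sqComp (D.horCompSq q (D.unitSq (D.right q)) h) (D.rightUnitor n) =
      D.sqComp (D.rightUnitor m) q
  -- coherence
  pentagon : ∀ {a b c d e : D.Obj} (m : D.Hor a b) (n : D.Hor b c) (p : D.Hor c d)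
    (o : D.Hor d e) (h₁ : D.right (D.assoc m n p) = D.left (D.sqId o))
    (h₂ : D.right (D.sqId m) = D.left (D.assoc n p o)),
    D.sqComp (D.sqComp (D.horCompSq (D.assoc m n p) (D.sqId o) h₁)
        (D.assoc m (D.horComp n p) o)) (D.horCompSq (D.sqId m) (D.assoc n p o) h₂) =
      D.sqComp (D.assoc (D.horComp m n) p o) (D.assoc m n (D.horComp p o))
  triangle : ∀ {a b c : D.Obj} (m : D.Hor a b) (n : D.Hor b c)
    (h₁ : D.right (D.sqId m) = D.left (D.leftUnitor n))
    (h₂ : D.right (D.rightUnitor m) = D.left (D.sqId n)),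
    D.sqComp (D.assoc m (D.unit b) n) (D.horCompSq (D.sqId m) (D.leftUnitor n) h₁) =
      D.horCompSq (D.rightUnitor m) (D.sqId n) h₂

namespace FineRewriting

/-- The isomorphism of pullbacks induced by an isomorphism of cospans. -/
def pullbackIso {C : Type u₁} [Category.{v₁} C] [HasPullbacks C] {x y z x' y' z' : C}
    {f : x ⟶ z} {g : y ⟶ z} {f' : x' ⟶ z'} {g' : y' ⟶ z'} (e₁ : x ≅ x') (e₂ : y ≅ y')
    (e₃ : z ≅ z') (h₁ : f ≫ e₃.hom = e₁.hom ≫ f') (h₂ : g ≫ e₃.hom = e₂.hom ≫ g') :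
    pullback f g ≅ pullback f' g' :=
  haveI := pullback.map_isIso f g f' g' e₁.hom e₂.hom e₃.hom h₁ h₂
  asIso (pullback.map f g f' g' e₁.hom e₂.hom e₃.hom h₁ h₂)

theorem pullbackIso_fst {C : Type u₁} [Category.{v₁} C] [HasPullbacks C] {x y z x' y' z' : C}
    {f : x ⟶ z} {g : y ⟶ z} {f' : x' ⟶ z'} {g' : y' ⟶ z'} (e₁ : x ≅ x') (e₂ : y ≅ y')
    (e₃ : z ≅ z') (h₁ : f ≫ e₃.hom = e₁.hom ≫ f') (h₂ : g ≫ e₃.hom = e₂.hom ≫ g') :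
    (pullbackIso e₁ e₂ e₃ h₁ h₂).hom ≫ pullback.fst f' g' = pullback.fst f g ≫ e₁.hom :=
  pullback.lift_fst _ _ _

theorem pullbackIso_snd {C : Type u₁} [Category.{v₁} C] [HasPullbacks C] {x y z x' y' z' : C}
    {f : x ⟶ z} {g : y ⟶ z} {f' : x' ⟶ z'} {g' : y' ⟶ z'} (e₁ : x ≅ x') (e₂ : y ≅ y')
    (e₃ : z ≅ z') (h₁ : f ≫ e₃.hom = e₁.hom ≫ f') (h₂ : g ≫ e₃.hom = e₂.hom ≫ g') :
    (pullbackIso e₁ e₂ e₃ h₁ h₂).hom ≫ pullback.snd f' g' = pullback.snd f g ≫ e₂.hom :=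
  pullback.lift_snd _ _ _

/-- The isomorphism of pushouts induced by an isomorphism of spans. -/
def pushoutIso {C : Type u₁} [Category.{v₁} C] [HasPushouts C] {x y z x' y' z' : C}
    {f : z ⟶ x} {g : z ⟶ y} {f' : z' ⟶ x'} {g' : z' ⟶ y'} (e₁ : x ≅ x') (e₂ : y ≅ y')
    (e₃ : z ≅ z') (h₁ : f ≫ e₁.hom = e₃.hom ≫ f') (h₂ : g ≫ e₂.hom = e₃.hom ≫ g') :
    pushout f g ≅ pushout f' g' :=
  haveI := pushout.map_isIso f g f' g' e₁.hom e₂.hom e₃.hom h₁ h₂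
  asIso (pushout.map f g f' g' e₁.hom e₂.hom e₃.hom h₁ h₂)

theorem inl_pushoutIso {C : Type u₁} [Category.{v₁} C] [HasPushouts C] {x y z x' y' z' : C}
    {f : z ⟶ x} {g : z ⟶ y} {f' : z' ⟶ x'} {g' : z' ⟶ y'} (e₁ : x ≅ x') (e₂ : y ≅ y')
    (e₃ : z ≅ z') (h₁ : f ≫ e₁.hom = e₃.hom ≫ f') (h₂ : g ≫ e₂.hom = e₃.hom ≫ g') :
    pushout.inl f g ≫ (pushoutIso e₁ e₂ e₃ h₁ h₂).hom = e₁.hom ≫ pushout.inl f' g' :=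
  pushout.inl_desc _ _ _

theorem inr_pushoutIso {C : Type u₁} [Category.{v₁} C] [HasPushouts C] {x y z x' y' z' : C}
    {f : z ⟶ x} {g : z ⟶ y} {f' : z' ⟶ x'} {g' : z' ⟶ y'} (e₁ : x ≅ x') (e₂ : y ≅ y')
    (e₃ : z ≅ z') (h₁ : f ≫ e₁.hom = e₃.hom ≫ f') (h₂ : g ≫ e₂.hom = e₃.hom ≫ g') :
    pushout.inr f g ≫ (pushoutIso e₁ e₂ e₃ h₁ h₂).hom = e₂.hom ≫ pushout.inr f' g' :=
  pushout.inr_desc _ _ _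

/-- The isomorphism of `z +_z x` with `x`. -/
def pushoutIdLeft {C : Type u₁} [Category.{v₁} C] [HasPushouts C] {x z : C} (f : z ⟶ x) :
    pushout (𝟙 z) f ≅ x where
  hom := pushout.desc f (𝟙 x) (by simp)
  inv := pushout.inr (𝟙 z) f
  hom_inv_id := by
    apply pushout.hom_ext
    · rw [pushout.inl_desc_assoc, ← pushout.condition, Category.id_comp, Category.comp_id]
    · rw [pushout.inr_desc_assoc, Category.id_comp, Category.comp_id]
  inv_hom_id := pushout.inr_desc _ _ _

/-- The isomorphism of `x +_z z` with `x`. -/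
def pushoutIdRight {C : Type u₁} [Category.{v₁} C] [HasPushouts C] {x z : C} (f : z ⟶ x) :
    pushout f (𝟙 z) ≅ x where
  hom := pushout.desc (𝟙 x) f (by simp)
  inv := pushout.inl f (𝟙 z)
  hom_inv_id := by
    apply pushout.hom_ext
    · rw [pushout.inl_desc_assoc, Category.id_comp, Category.comp_id]
    · rw [pushout.inr_desc_assoc, pushout.condition, Category.id_comp, Category.comp_id]
  inv_hom_id := pushout.inl_desc _ _ _

/-! ## Spans of isomorphisms, up to isomorphism -/

section IsoSpan

variable {A : Type u₁} [Category.{v₁} A]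

/-- A span `a ⟵ apex ⟶ c` whose two legs are invertible. -/
structure IsoSpan (a c : A) where
  apex : A
  fst : apex ⟶ a
  snd : apex ⟶ c
  fst_iso : IsIso fst
  snd_iso : IsIso snd

namespace IsoSpan

attribute [instance] fst_iso snd_iso

/-- An arrow between apexes is compatible with the legs of the two spans. -/
def Compat {a c : A} (s t : IsoSpan a c) (e : s.apex ⟶ t.apex) : Prop :=
  e ≫ t.fst = s.fst ∧ e ≫ t.snd = s.snd

/-- Two spans are equivalent if they are isomorphic. -/
def Equivalent {a c : A} (s t : IsoSpan a c) : Prop :=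
  ∃ e : s.apex ≅ t.apex, Compat s t e.hom

theorem Compat.symm {a c : A} {s t : IsoSpan a c} {e : s.apex ≅ t.apex}
    (h : Compat s t e.hom) : Compat t s e.inv := by
  constructor
  · rw [← h.1, Iso.inv_hom_id_assoc]
  · rw [← h.2, Iso.inv_hom_id_assoc]

theorem Compat.trans {a c : A} {s t r : IsoSpan a c} {e : s.apex ⟶ t.apex} {f : t.apex ⟶ r.apex}
    (h : Compat s t e) (h' : Compat t r f) : Compat s r (e ≫ f) := by
  constructor
  · rw [Category.assoc, h'.1, h.1]
  · rw [Category.assoc, h'.2, h.2]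

instance setoid (a c : A) : Setoid (IsoSpan a c) where
  r := Equivalent
  iseqv :=
    { refl := fun s => ⟨Iso.refl _, by simp [Compat]⟩
      symm := fun ⟨e, h⟩ => ⟨e.symm, h.symm⟩
      trans := fun ⟨e, h⟩ ⟨f, h'⟩ => ⟨e ≪≫ f, h.trans h'⟩ }

/-- The identity span. -/
abbrev id (a : A) : IsoSpan a a :=
  ⟨a, 𝟙 a, 𝟙 a, inferInstance, inferInstance⟩

/-- Composition of spans by pullback. -/
abbrev comp [HasPullbacks A] {a b c : A} (s : IsoSpan a b) (t : IsoSpan b c) : IsoSpan a c where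
  apex := pullback s.snd t.fst
  fst := pullback.fst s.snd t.fst ≫ s.fst
  snd := pullback.snd s.snd t.fst ≫ t.snd
  fst_iso := inferInstance
  snd_iso := inferInstance

/-- The projection from the apex of a composite to the apex of the first factor. -/
def compFst [HasPullbacks A] {a b c : A} (s : IsoSpan a b) (t : IsoSpan b c) :
    (s.comp t).apex ⟶ s.apex :=
  pullback.fst s.snd t.fst

/-- The projection from the apex of a composite to the apex of the second factor. -/
def compSnd [HasPullbacks A] {a b c : A} (s : IsoSpan a b) (t : IsoSpan b c) :
    (s.comp t).apex ⟶ t.apex :=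
  pullback.snd s.snd t.fst

theorem comp_condition [HasPullbacks A] {a b c : A} (s : IsoSpan a b) (t : IsoSpan b c) :
    compFst s t ≫ s.snd = compSnd s t ≫ t.fst :=
  pullback.condition

theorem comp_fst [HasPullbacks A] {a b c : A} (s : IsoSpan a b) (t : IsoSpan b c) :
    (s.comp t).fst = compFst s t ≫ s.fst := rfl

theorem comp_snd [HasPullbacks A] {a b c : A} (s : IsoSpan a b) (t : IsoSpan b c) :
    (s.comp t).snd = compSnd s t ≫ t.snd := rfl

/-- The isomorphism of composite spans induced by isomorphisms of the factors. -/
def compIso [HasPullbacks A] {a b c : A} {s s' : IsoSpan a b} {t t' : IsoSpan b c}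
    (e : s.apex ≅ s'.apex) (he : Compat s s' e.hom) (f : t.apex ≅ t'.apex)
    (hf : Compat t t' f.hom) : (s.comp t).apex ≅ (s'.comp t').apex :=
  pullbackIso e f (Iso.refl b) (by simp [he.2]) (by simp [hf.1])

theorem compIso_fst [HasPullbacks A] {a b c : A} {s s' : IsoSpan a b} {t t' : IsoSpan b c}
    (e : s.apex ≅ s'.apex) (he : Compat s s' e.hom) (f : t.apex ≅ t'.apex)
    (hf : Compat t t' f.hom) :
    (compIso e he f hf).hom ≫ compFst s' t' = compFst s t ≫ e.hom :=
  pullback.lift_fst _ _ _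

theorem compIso_snd [HasPullbacks A] {a b c : A} {s s' : IsoSpan a b} {t t' : IsoSpan b c}
    (e : s.apex ≅ s'.apex) (he : Compat s s' e.hom) (f : t.apex ≅ t'.apex)
    (hf : Compat t t' f.hom) :
    (compIso e he f hf).hom ≫ compSnd s' t' = compSnd s t ≫ f.hom :=
  pullback.lift_snd _ _ _

theorem compIso_compat [HasPullbacks A] {a b c : A} {s s' : IsoSpan a b} {t t' : IsoSpan b c}
    (e : s.apex ≅ s'.apex) (he : Compat s s' e.hom) (f : t.apex ≅ t'.apex)
    (hf : Compat t t' f.hom) :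
    Compat (s.comp t) (s'.comp t') (compIso e he f hf).hom := by
  constructor
  · rw [comp_fst, comp_fst, reassoc_of% compIso_fst e he f hf, he.1]
  · rw [comp_snd, comp_snd, reassoc_of% compIso_snd e he f hf, hf.2]

/-- The arrow between apexes determined by the first legs. For equivalent spans it is the unique
isomorphism of spans between them. -/
def transport {a c : A} (s t : IsoSpan a c) : s.apex ⟶ t.apex :=
  s.fst ≫ inv t.fst

theorem transport_fst {a c : A} (s t : IsoSpan a c) : transport s t ≫ t.fst = s.fst := by
  simp [transport]

theorem eq_transport {a c : A} {s t : IsoSpan a c} {e : s.apex ⟶ t.apex} (h : Compat s t e) :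
    e = transport s t := by
  rw [transport, IsIso.eq_comp_inv, h.1]

theorem transport_snd {a c : A} {s t : IsoSpan a c} (h : s ≈ t) :
    transport s t ≫ t.snd = s.snd := by
  obtain ⟨e, he⟩ := h
  rw [← eq_transport he, he.2]

end IsoSpan

/-- Vertical arrows: isomorphism classes of spans with invertible legs. -/
def VArrow (a c : A) : Type max u₁ v₁ := Quotient (IsoSpan.setoid a c)

/-- Composition of vertical arrows. -/
def VArrow.comp [HasPullbacks A] {a b c : A} : VArrow a b → VArrow b c → VArrow a c :=
  Quotient.map₂ IsoSpan.comp (by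
    rintro s s' ⟨e, he⟩ t t' ⟨f, hf⟩
    exact ⟨IsoSpan.compIso e he f hf, IsoSpan.compIso_compat e he f hf⟩)

end IsoSpan

/-! ## Structured cospans and fine rewrites -/

section Fine

variable {A : Type u₁} [Category.{v₁} A] {X : Type u₂} [Category.{v₂} X] (L : A ⥤ X)

/-- A structured cospan `L a ⟶ apex ⟵ L b`. -/
structure StrCospan (a b : A) where
  apex : X
  inl : L.obj a ⟶ apex
  inr : L.obj b ⟶ apex

variable {L}

namespace StrCospan

/-- The identity cospan on `L a`. -/
abbrev unit (a : A) : StrCospan L a a := ⟨L.obj a, 𝟙 _, 𝟙 _⟩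

/-- Composition of structured cospans by pushout. -/
abbrev comp [HasPushouts X] {a b c : A} (m : StrCospan L a b) (n : StrCospan L b c) :
    StrCospan L a c where
  apex := pushout m.inr n.inl
  inl := m.inl ≫ pushout.inl m.inr n.inl
  inr := n.inr ≫ pushout.inr m.inr n.inl

end StrCospan

/-- A span of structured cospans from `m` (top) to `n` (bottom) in which the outer spans are the
images under `L` of spans of isomorphisms in `A` and the two middle legs are monic. -/
structure FineSpan {a b c d : A} (m : StrCospan L a b) (n : StrCospan L c d) where
  left : IsoSpan a c
  right : IsoSpan b d
  /-- the middle row -/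
  mid : StrCospan L left.apex right.apex
  up : mid.apex ⟶ m.apex
  down : mid.apex ⟶ n.apex
  mono_up : Mono up
  mono_down : Mono down
  inl_up : mid.inl ≫ up = L.map left.fst ≫ m.inl
  inl_down : mid.inl ≫ down = L.map left.snd ≫ n.inl
  inr_up : mid.inr ≫ up = L.map right.fst ≫ m.inr
  inr_down : mid.inr ≫ down = L.map right.snd ≫ n.inr

namespace FineSpan

attribute [instance] mono_up mono_down

/-- Isomorphism of spans of structured cospans with the same top and bottom cospans. -/
def Equivalent {a b c d : A} {m : StrCospan L a b} {n : StrCospan L c d}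
    (r s : FineSpan m n) : Prop :=
  ∃ (el : r.left.apex ≅ s.left.apex) (er : r.right.apex ≅ s.right.apex)
    (θ : r.mid.apex ≅ s.mid.apex),
    IsoSpan.Compat r.left s.left el.hom ∧ IsoSpan.Compat r.right s.right er.hom ∧
    θ.hom ≫ s.up = r.up ∧ θ.hom ≫ s.down = r.down ∧
    r.mid.inl ≫ θ.hom = L.map el.hom ≫ s.mid.inl ∧
    r.mid.inr ≫ θ.hom = L.map er.hom ≫ s.mid.inr

instance setoid {a b c d : A} (m : StrCospan L a b) (n : StrCospan L c d) :
    Setoid (FineSpan m n) where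
  r := Equivalent
  iseqv :=
    { refl := fun r => ⟨Iso.refl _, Iso.refl _, Iso.refl _, by simp [IsoSpan.Compat]⟩
      symm := by
        rintro r s ⟨el, er, θ, hl, hr, hu, hd, hil, hir⟩
        refine ⟨el.symm, er.symm, θ.symm, hl.symm, hr.symm, ?_, ?_, ?_, ?_⟩
        · rw [← hu]; simp
        · rw [← hd]; simp
        · rw [Iso.symm_hom, Iso.comp_inv_eq, Iso.symm_hom, Category.assoc, hil,
            ← Category.assoc, ← L.map_comp, Iso.inv_hom_id, L.map_id, Category.id_comp]
        · rw [Iso.symm_hom, Iso.comp_inv_eq, Iso.symm_hom, Category.assoc, hir,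
            ← Category.assoc, ← L.map_comp, Iso.inv_hom_id, L.map_id, Category.id_comp]
      trans := by
        rintro r s t ⟨el, er, θ, hl, hr, hu, hd, hil, hir⟩ ⟨el', er', θ', hl', hr', hu', hd',
          hil', hir'⟩
        refine ⟨el ≪≫ el', er ≪≫ er', θ ≪≫ θ', hl.trans hl', hr.trans hr', ?_, ?_, ?_, ?_⟩
        · simp [hu', hu]
        · simp [hd', hd]
        · simp [reassoc_of% hil, hil']
        · simp [reassoc_of% hir, hir'] }

/-- The identity span on a structured cospan. -/
abbrev id {a b : A} (m : StrCospan L a b) : FineSpan m m where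
  left := IsoSpan.id a
  right := IsoSpan.id b
  mid := m
  up := 𝟙 _
  down := 𝟙 _
  mono_up := inferInstance
  mono_down := inferInstance
  inl_up := by simp [IsoSpan.id]
  inl_down := by simp [IsoSpan.id]
  inr_up := by simp [IsoSpan.id]
  inr_down := by simp [IsoSpan.id]

/-- The globular span given by an isomorphism of structured cospans. -/
abbrev ofIso {a b : A} {m n : StrCospan L a b} (e : m.apex ≅ n.apex)
    (hl : m.inl ≫ e.hom = n.inl) (hr : m.inr ≫ e.hom = n.inr) : FineSpan m n where
  left := IsoSpan.id a
  right := IsoSpan.id b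
  mid := m
  up := 𝟙 _
  down := e.hom
  mono_up := inferInstance
  mono_down := inferInstance
  inl_up := by simp [IsoSpan.id]
  inl_down := by simp [IsoSpan.id, hl]
  inr_up := by simp [IsoSpan.id]
  inr_down := by simp [IsoSpan.id, hr]

theorem mono_map (L : A ⥤ X) {a b : A} (f : a ⟶ b) [IsIso f] : Mono (L.map f) := inferInstance

/-- The unit square on a span of isomorphisms. -/
abbrev unit {a c : A} (s : IsoSpan a c) :
    FineSpan (StrCospan.unit (L := L) a) (StrCospan.unit (L := L) c) where
  left := s
  right := s
  mid := StrCospan.unit s.apex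
  up := L.map s.fst
  down := L.map s.snd
  mono_up := mono_map L s.fst
  mono_down := mono_map L s.snd
  inl_up := by simp [StrCospan.unit]
  inl_down := by simp [StrCospan.unit]
  inr_up := by simp [StrCospan.unit]
  inr_down := by simp [StrCospan.unit]

section Vertical

variable [HasPullbacks A] [HasPullbacks X] {a b c d e f : A} {m : StrCospan L a b}
  {n : StrCospan L c d} {p : StrCospan L e f}

/-- The middle row of the vertical composite: the pullback of the two middle rows. -/
abbrev vMid (r : FineSpan m n) (s : FineSpan n p) :
    StrCospan L (r.left.comp s.left).apex (r.right.comp s.right).apex where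
  apex := pullback r.down s.up
  inl := pullback.lift
    (L.map (r.left.compFst s.left) ≫ r.mid.inl) (L.map (r.left.compSnd s.left) ≫ s.mid.inl) (by
      rw [Category.assoc, Category.assoc, r.inl_down, s.inl_up, ← L.map_comp_assoc,
        ← L.map_comp_assoc, IsoSpan.comp_condition])
  inr := pullback.lift
    (L.map (r.right.compFst s.right) ≫ r.mid.inr) (L.map (r.right.compSnd s.right) ≫ s.mid.inr)
    (by
      rw [Category.assoc, Category.assoc, r.inr_down, s.inr_up, ← L.map_comp_assoc,
        ← L.map_comp_assoc, IsoSpan.comp_condition])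

/-- Vertical composition by pullback. -/
abbrev vComp (r : FineSpan m n) (s : FineSpan n p) : FineSpan m p where
  left := r.left.comp s.left
  right := r.right.comp s.right
  mid := vMid r s
  up := pullback.fst r.down s.up ≫ r.up
  down := pullback.snd r.down s.up ≫ s.down
  mono_up := mono_comp (pullback.fst r.down s.up) r.up
  mono_down := mono_comp (pullback.snd r.down s.up) s.down
  inl_up := by
    rw [pullback.lift_fst_assoc, Category.assoc, r.inl_up, IsoSpan.comp_fst,
      L.map_comp_assoc]
  inl_down := by
    rw [pullback.lift_snd_assoc, Category.assoc, s.inl_down, IsoSpan.comp_snd,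
      L.map_comp_assoc]
  inr_up := by
    rw [pullback.lift_fst_assoc, Category.assoc, r.inr_up, IsoSpan.comp_fst,
      L.map_comp_assoc]
  inr_down := by
    rw [pullback.lift_snd_assoc, Category.assoc, s.inr_down, IsoSpan.comp_snd,
      L.map_comp_assoc]

theorem vComp_equivalent {r r' : FineSpan m n} {s s' : FineSpan n p} (hr : r ≈ r')
    (hs : s ≈ s') : r.vComp s ≈ r'.vComp s' := by
  obtain ⟨el, er, θ, hl, hr, hu, hd, hil, hir⟩ := hr
  obtain ⟨el', er', θ', hl', hr', hu', hd', hil', hir'⟩ := hs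
  refine ⟨IsoSpan.compIso el hl el' hl', IsoSpan.compIso er hr er' hr',
    pullbackIso θ θ' (Iso.refl _) (by simp [hd]) (by simp [hu']),
    IsoSpan.compIso_compat _ _ _ _, IsoSpan.compIso_compat _ _ _ _, ?_, ?_, ?_, ?_⟩
  · rw [reassoc_of% pullbackIso_fst, hu]
  · rw [reassoc_of% pullbackIso_snd, hd']
  · apply pullback.hom_ext
    · rw [Category.assoc, pullbackIso_fst, pullback.lift_fst_assoc, Category.assoc, hil,
        Category.assoc, pullback.lift_fst, ← L.map_comp_assoc, ← L.map_comp_assoc,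
        IsoSpan.compIso_fst]
    · rw [Category.assoc, pullbackIso_snd, pullback.lift_snd_assoc, Category.assoc, hil',
        Category.assoc, pullback.lift_snd, ← L.map_comp_assoc, ← L.map_comp_assoc,
        IsoSpan.compIso_snd]
  · apply pullback.hom_ext
    · rw [Category.assoc, pullbackIso_fst, pullback.lift_fst_assoc, Category.assoc, hir,
        Category.assoc, pullback.lift_fst, ← L.map_comp_assoc, ← L.map_comp_assoc,
        IsoSpan.compIso_fst]
    · rw [Category.assoc, pullbackIso_snd, pullback.lift_snd_assoc, Category.assoc, hir',
        Category.assoc, pullback.lift_snd, ← L.map_comp_assoc, ← L.map_comp_assoc,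
        IsoSpan.compIso_snd]

end Vertical

section Horizontal

variable [HasPushouts X] {a b c a' b' c' : A} {m : StrCospan L a b} {n : StrCospan L a' b'}
  {m' : StrCospan L b c} {n' : StrCospan L b' c'}

/-- The middle row of the horizontal composite: the pushout of the two middle rows over the
common (up to the unique isomorphism of spans) foot. -/
abbrev hMid (r : FineSpan m n) (s : FineSpan m' n') : StrCospan L r.left.apex s.right.apex where
  apex := pushout r.mid.inr (L.map (r.right.transport s.left) ≫ s.mid.inl)
  inl := r.mid.inl ≫ pushout.inl _ _
  inr := s.mid.inr ≫ pushout.inr _ _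

/-- The arrow from the middle to the top row of the horizontal composite. -/
def hUp (r : FineSpan m n) (s : FineSpan m' n') : (hMid r s).apex ⟶ (m.comp m').apex :=
  pushout.desc (r.up ≫ pushout.inl m.inr m'.inl) (s.up ≫ pushout.inr m.inr m'.inl) (by
    rw [reassoc_of% r.inr_up, Category.assoc, reassoc_of% s.inl_up, ← L.map_comp_assoc,
      IsoSpan.transport_fst, pushout.condition])

/-- The arrow from the middle to the bottom row of the horizontal composite. -/
def hDown (r : FineSpan m n) (s : FineSpan m' n') (h : r.right ≈ s.left) :
    (hMid r s).apex ⟶ (n.comp n').apex :=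
  pushout.desc (r.down ≫ pushout.inl n.inr n'.inl) (s.down ≫ pushout.inr n.inr n'.inl) (by
    rw [reassoc_of% r.inr_down, Category.assoc, reassoc_of% s.inl_down, ← L.map_comp_assoc,
      IsoSpan.transport_snd h, pushout.condition])

theorem inl_hUp (r : FineSpan m n) (s : FineSpan m' n') :
    pushout.inl _ _ ≫ hUp r s = r.up ≫ pushout.inl m.inr m'.inl :=
  pushout.inl_desc _ _ _

theorem inr_hUp (r : FineSpan m n) (s : FineSpan m' n') :
    pushout.inr _ _ ≫ hUp r s = s.up ≫ pushout.inr m.inr m'.inl :=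
  pushout.inr_desc _ _ _

theorem inl_hDown (r : FineSpan m n) (s : FineSpan m' n') (h : r.right ≈ s.left) :
    pushout.inl _ _ ≫ hDown r s h = r.down ≫ pushout.inl n.inr n'.inl :=
  pushout.inl_desc _ _ _

theorem inr_hDown (r : FineSpan m n) (s : FineSpan m' n') (h : r.right ≈ s.left) :
    pushout.inr _ _ ≫ hDown r s h = s.down ≫ pushout.inr n.inr n'.inl :=
  pushout.inr_desc _ _ _

end Horizontal

end FineSpan

variable (L) in
/-- Horizontal composites of spans of structured cospans with monic legs have monic legs. -/
def HorizontalCompositesFine [HasPushouts X] : Prop :=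
  ∀ ⦃a b c a' b' c' : A⦄ ⦃m : StrCospan L a b⦄ ⦃n : StrCospan L a' b'⦄
    ⦃m' : StrCospan L b c⦄ ⦃n' : StrCospan L b' c'⦄ (r : FineSpan m n) (s : FineSpan m' n')
    (h : r.right ≈ s.left),
    Mono (r.hUp s) ∧ Mono (r.hDown s h)

namespace FineSpan

section Horizontal

variable [HasPushouts X] {a b c a' b' c' : A} {m : StrCospan L a b} {n : StrCospan L a' b'}
  {m' : StrCospan L b c} {n' : StrCospan L b' c'}

/-- Horizontal composition by pushout. -/
abbrev hComp (H : HorizontalCompositesFine L) (r : FineSpan m n) (s : FineSpan m' n')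
    (h : r.right ≈ s.left) : FineSpan (m.comp m') (n.comp n') where
  left := r.left
  right := s.right
  mid := hMid r s
  up := hUp r s
  down := hDown r s h
  mono_up := (H r s h).1
  mono_down := (H r s h).2
  inl_up := by
    rw [Category.assoc, inl_hUp, reassoc_of% r.inl_up]
  inl_down := by
    rw [Category.assoc, inl_hDown, reassoc_of% r.inl_down]
  inr_up := by
    rw [Category.assoc, inr_hUp, reassoc_of% s.inr_up]
  inr_down := by
    rw [Category.assoc, inr_hDown, reassoc_of% s.inr_down]

theorem hComp_equivalent (H : HorizontalCompositesFine L) {r r' : FineSpan m n}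
    {s s' : FineSpan m' n'} (hr : r ≈ r') (hs : s ≈ s') (h : r.right ≈ s.left)
    (h' : r'.right ≈ s'.left) : hComp H r s h ≈ hComp H r' s' h' := by
  obtain ⟨el, er, θ, hl, hr, hu, hd, hil, hir⟩ := hr
  obtain ⟨el', er', θ', hl', hr', hu', hd', hil', hir'⟩ := hs
  have key : r.right.transport s.left ≫ el'.hom = er.hom ≫ r'.right.transport s'.left := by
    rw [← cancel_mono s'.left.fst, Category.assoc, Category.assoc, hl'.1,
      IsoSpan.transport_fst, IsoSpan.transport_fst, hr.1]
  refine ⟨el, er', pushoutIso θ θ' (L.mapIso er) hir ?_, hl, hr', ?_, ?_, ?_, ?_⟩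
  · rw [L.mapIso_hom]
    rw [Category.assoc, hil', ← L.map_comp_assoc, key, L.map_comp_assoc]
  · apply pushout.hom_ext
    · rw [reassoc_of% inl_pushoutIso, inl_hUp, inl_hUp,
        reassoc_of% hu]
    · rw [reassoc_of% inr_pushoutIso, inr_hUp, inr_hUp, reassoc_of% hu']
  · apply pushout.hom_ext
    · rw [reassoc_of% inl_pushoutIso, inl_hDown, inl_hDown, reassoc_of% hd]
    · rw [reassoc_of% inr_pushoutIso, inr_hDown, inr_hDown, reassoc_of% hd']
  · rw [Category.assoc, inl_pushoutIso, reassoc_of% hil]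
  · rw [Category.assoc, inr_pushoutIso, reassoc_of% hir']

end Horizontal

end FineSpan

/-- Fine rewrites of structured cospans: isomorphism classes of spans of structured cospans with
invertible outer and monic middle legs. -/
def FineRewrite {a b c d : A} (m : StrCospan L a b) (n : StrCospan L c d) :
    Type max u₁ v₁ u₂ v₂ := Quotient (FineSpan.setoid m n)

namespace FineRewrite

variable {a b c d : A} {m : StrCospan L a b} {n : StrCospan L c d}

/-- The left vertical edge. -/
def left : FineRewrite m n → VArrow a c :=
  Quotient.map FineSpan.left (by rintro r s ⟨el, er, θ, hl, -⟩; exact ⟨el, hl⟩)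

/-- The right vertical edge. -/
def right : FineRewrite m n → VArrow b d :=
  Quotient.map FineSpan.right (by rintro r s ⟨el, er, θ, -, hr, -⟩; exact ⟨er, hr⟩)

/-- The unit square on a vertical arrow. -/
def unit : VArrow a c → FineRewrite (StrCospan.unit (L := L) a) (StrCospan.unit (L := L) c) :=
  Quotient.map FineSpan.unit (by
    rintro s t ⟨e, he⟩
    refine ⟨e, e, L.mapIso e, he, he, ?_, ?_, ?_, ?_⟩
    · simp [FineSpan.unit, ← L.map_comp, he.1]
    · simp [FineSpan.unit, ← L.map_comp, he.2]
    · simp [FineSpan.unit, StrCospan.unit]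
    · simp [FineSpan.unit, StrCospan.unit])

/-- Vertical composition of fine rewrites. -/
def vComp [HasPullbacks A] [HasPullbacks X] {e f : A} {p : StrCospan L e f} :
    FineRewrite m n → FineRewrite n p → FineRewrite m p :=
  Quotient.map₂ FineSpan.vComp (fun _ _ hr _ _ hs => FineSpan.vComp_equivalent hr hs)

/-- Horizontal composition of fine rewrites that share a vertical edge, computed on any
representatives. -/
def hComp [HasPushouts X] (H : HorizontalCompositesFine L) {b' d' : A} {m' : StrCospan L b b'}
    {n' : StrCospan L d d'} (q : FineRewrite m n) (q' : FineRewrite m' n')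
    (h : right q = left q') : FineRewrite (m.comp m') (n.comp n') :=
  Quotient.pliftOn q
    (fun r hr => Quotient.pliftOn q'
      (fun s hs => Quotient.mk _ (FineSpan.hComp H r s
        (Quotient.exact (by subst hr hs; exact h))))
      (fun _ _ _ _ hs => Quotient.sound (FineSpan.hComp_equivalent H (Setoid.refl _) hs _ _)))
    (fun r r' _ _ hr => by
      induction q' using Quotient.inductionOn with
      | h s => exact Quotient.sound (FineSpan.hComp_equivalent H hr (Setoid.refl _) _ _))

end FineRewrite

/-! ## The double category of fine rewrites -/

section Coherence

variable [HasPushouts X]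

/-- The associativity isomorphism of iterated pushouts, as a span of structured cospans. -/
def assocSpan {a b c d : A} (m : StrCospan L a b) (n : StrCospan L b c) (p : StrCospan L c d) :
    FineSpan ((m.comp n).comp p) (m.comp (n.comp p)) :=
  FineSpan.ofIso (pushoutAssoc m.inr n.inl n.inr p.inl)
    (by simp [StrCospan.comp]) (by simp [StrCospan.comp])

/-- The isomorphism of `L a +_{L a} x` with `x`, as a span of structured cospans. -/
def leftUnitorSpan {a b : A} (m : StrCospan L a b) : FineSpan ((StrCospan.unit a).comp m) m :=
  FineSpan.ofIso (pushoutIdLeft m.inl)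
    (by rw [Category.assoc, Category.id_comp]; exact pushout.inl_desc _ _ _)
    (by rw [Category.assoc]; exact (m.inr ≫= pushout.inr_desc _ _ _).trans (Category.comp_id _))

/-- The isomorphism of `x +_{L b} L b` with `x`, as a span of structured cospans. -/
def rightUnitorSpan {a b : A} (m : StrCospan L a b) : FineSpan (m.comp (StrCospan.unit b)) m :=
  FineSpan.ofIso (pushoutIdRight m.inr)
    (by rw [Category.assoc]; exact (m.inl ≫= pushout.inl_desc _ _ _).trans (Category.comp_id _))
    (by rw [Category.assoc, Category.id_comp]; exact pushout.inr_desc _ _ _)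

end Coherence

variable (L) in
/-- The data of the double category of fine rewrites of `L`-structured cospans. -/
def fineRewriteData [HasPullbacks A] [HasPullbacks X] [HasPushouts X]
    (H : HorizontalCompositesFine L) :
    DoubleCategoryData.{u₁, max u₁ v₁, max u₂ v₂, max u₁ v₁ u₂ v₂} where
  Obj := A
  Ver := fun a c => VArrow a c
  Hor := fun a b => StrCospan L a b
  Sq := fun m n => FineRewrite m n
  verId := fun a => Quotient.mk _ (IsoSpan.id a)
  verComp := VArrow.comp
  left := FineRewrite.left
  right := FineRewrite.right
  sqId := fun m => Quotient.mk _ (FineSpan.id m)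
  sqComp := FineRewrite.vComp
  unit := StrCospan.unit
  unitSq := FineRewrite.unit
  horComp := StrCospan.comp
  horCompSq := FineRewrite.hComp H
  assoc := fun m n p => Quotient.mk _ (assocSpan m n p)
  leftUnitor := fun m => Quotient.mk _ (leftUnitorSpan m)
  rightUnitor := fun m => Quotient.mk _ (rightUnitorSpan m)

end Fine

end FineRewriting

end

/-! Most of the structure is formal. The topos hypothesis on `X` carries three facts: pushouts
exist, a pushout of monomorphisms of spans is monic, and interchange holds.

Existence is Paré's argument. The contravariant power functor from `Xᵒᵖ` to `X` is right adjoint to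
its own opposite and faithful. By the Beck–Chevalley condition (`directImage_comp_map`) it sends the
equalizer of a coreflexive pair to a split coequalizer (`powerSplitCoequalizer`). It is therefore
monadic, so it creates limits, and the pullbacks of `X` yield pullbacks in `Xᵒᵖ`, that is, pushouts
in `X`.

For monicity, the pushout of a monomorphism is monic and the pushout square is also a pullback
(`mono_and_isPullback_of_isPushout`): the singleton arrow into a power object factors through the
pushout. In a horizontal composite the glued feet are isomorphic, so the map between pushouts only
enlarges the two apexes. Enlarging them one at a time gives two pushouts of monomorphisms
(`mono_and_isPullback_of_isPushout_map`).

For interchange, let `D` be the composite of the two intermediate cospans. The middle objects of the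
two sides are subobjects of `D`: an intersection of pushouts and a pushout of intersections. A
subobject of `D` is determined by its characteristic arrow, hence by its inverse images along the
two jointly epimorphic legs of `D`. On each leg both subobjects restrict to the same intersection
(`isIso_of_isPushout_intersection`).

The remaining axioms need little bookkeeping. A span of isomorphisms is, up to equivalence, just an
isomorphism of `A`, and monic legs make the compatibility of feet automatic (`equiv_of_isIso`).
Associators and unitors are graphs of isomorphisms, so the coherence laws become equations between
arrows out of pushouts. -/

namespace CategoryTheory.ElementaryTopos

open MonoidalCategory CartesianMonoidalCategory MonoidalClosed HasSubobjectClassifier Opposite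

noncomputable section

variable {C : Type u₁} [Category.{v₁} C]

/-- A commutative square with unique lifts of generalized elements is a pullback. -/
theorem isPullback_of_existsUnique {P X Y Z : C} {fst : P ⟶ X} {snd : P ⟶ Y} {f : X ⟶ Z}
    {g : Y ⟶ Z} (w : fst ≫ f = snd ≫ g)
    (h : ∀ (T : C) (x : T ⟶ X) (y : T ⟶ Y), x ≫ f = y ≫ g → ∃ l : T ⟶ P, l ≫ fst = x ∧ l ≫ snd = y)
    (h' : ∀ (T : C) (l l' : T ⟶ P), l ≫ fst = l' ≫ fst → l ≫ snd = l' ≫ snd → l = l') :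
    IsPullback fst snd f g := by
  refine ⟨⟨w⟩, ⟨PullbackCone.IsLimit.mk w (fun s => (h _ _ _ s.condition).choose)
    (fun s => (h _ _ _ s.condition).choose_spec.1)
    (fun s => (h _ _ _ s.condition).choose_spec.2) (fun s m h₁ h₂ => ?_)⟩⟩
  exact h' _ _ _ (h₁.trans (h _ _ _ s.condition).choose_spec.1.symm)
    (h₂.trans (h _ _ _ s.condition).choose_spec.2.symm)

/-! ### Subobjects and characteristic arrows -/

section Classifier

variable [HasSubobjectClassifier C]

theorem exists_lift_of_comp_χ {T U Y : C} {m : U ⟶ Y} [Mono m] (h : T ⟶ Y)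
    (w : h ≫ χ m = Subobject.Classifier.χ₀ _ T ≫ truth C) : ∃ l : T ⟶ U, l ≫ m = h :=
  ⟨(isPullback_χ m).lift _ _ w, (isPullback_χ m).lift_fst _ _ w⟩

theorem comp_comp_χ {T U Y : C} {m : U ⟶ Y} [Mono m] (l : T ⟶ U) :
    l ≫ m ≫ χ m = Subobject.Classifier.χ₀ _ T ≫ truth C := by
  rw [HasSubobjectClassifier.comm, ← Category.assoc]
  congr 1
  exact Subsingleton.elim _ _

theorem comp_χ {U Y V Y' : C} {m : U ⟶ Y} [Mono m] {m' : V ⟶ Y'} [Mono m'] {k : Y' ⟶ Y}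
    {k' : V ⟶ U} (h : IsPullback m' k' k m) : k ≫ χ m = χ m' := by
  apply unique
  have h' := h.paste_vert (isPullback_χ m)
  rwa [Subsingleton.elim (k' ≫ Subobject.Classifier.χ₀ _ U) (Subobject.Classifier.χ₀ _ V)] at h'

/-- Two subobjects of `D` whose inverse images along two jointly epimorphic arrows agree. -/
theorem exists_iso_of_isPullback {D x x' S S' w w' : C} {i : x ⟶ D} {i' : x' ⟶ D} {u : S ⟶ D}
    {v : S' ⟶ D} [Mono u] [Mono v]
    (hD : ∀ {T : C} (f g : D ⟶ T), i ≫ f = i ≫ g → i' ≫ f = i' ≫ g → f = g)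
    {p : w ⟶ S} {q : w ⟶ S'} {j : w ⟶ x} {p' : w' ⟶ S} {q' : w' ⟶ S'} {j' : w' ⟶ x'}
    [Mono j] [Mono j'] (h₁ : IsPullback j p i u) (h₂ : IsPullback j q i v)
    (h₁' : IsPullback j' p' i' u) (h₂' : IsPullback j' q' i' v) :
    ∃ e : S ≅ S', e.hom ≫ v = u := by
  -- Restricted to either leg, the two characteristic arrows classify the same inverse image. Joint
  -- epimorphy then identifies them on all of `D`.
  have hχ : χ u = χ v := by
    apply hD
    · rw [comp_χ h₁, comp_χ h₂]
    · rw [comp_χ h₁', comp_χ h₂']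
  obtain ⟨f, hf⟩ := exists_lift_of_comp_χ (m := v) u (by rw [← hχ, HasSubobjectClassifier.comm])
  obtain ⟨g, hg⟩ := exists_lift_of_comp_χ (m := u) v (by rw [hχ, HasSubobjectClassifier.comm])
  exact ⟨⟨f, g, by rw [← cancel_mono u, Category.assoc, hg, hf, Category.id_comp],
    by rw [← cancel_mono v, Category.assoc, hf, hg, Category.id_comp]⟩, hf⟩

end Classifier

/-! ### Monomorphisms and pullbacks under products -/

section Cartesian

variable [CartesianMonoidalCategory C]

instance mono_lift_id (A : C) : Mono (lift (𝟙 A) (𝟙 A)) :=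
  mono_of_mono_fac (lift_fst (𝟙 A) (𝟙 A))

instance mono_lift_of_mono {A B D : C} (f : A ⟶ B) (m : A ⟶ D) [Mono m] : Mono (lift f m) :=
  mono_of_mono_fac (lift_snd f m)

instance mono_whiskerRight {A B : C} (m : A ⟶ B) [Mono m] (T : C) : Mono (m ▷ T) where
  right_cancellation f g h := by
    have h₁ := h =≫ fst _ _
    have h₂ := h =≫ snd _ _
    simp only [Category.assoc, whiskerRight_fst, whiskerRight_snd] at h₁ h₂
    refine CartesianMonoidalCategory.hom_ext _ _ ?_ h₂
    rwa [← cancel_mono m, Category.assoc, Category.assoc]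

theorem isPullback_whiskerRight {D A B E : C} {p : D ⟶ A} {q : D ⟶ E} {m : A ⟶ B} {f : E ⟶ B}
    (h : IsPullback q p f m) (T : C) : IsPullback (q ▷ T) (p ▷ T) (f ▷ T) (m ▷ T) := by
  apply isPullback_of_existsUnique
  · rw [← comp_whiskerRight, h.w, comp_whiskerRight]
  · intro Z x y hxy
    have h₁ := hxy =≫ fst _ _
    have h₂ := hxy =≫ snd _ _
    simp only [Category.assoc, whiskerRight_fst, whiskerRight_snd] at h₁ h₂
    refine ⟨lift (h.lift (x ≫ fst _ _) (y ≫ fst _ _) (by simpa using h₁)) (x ≫ snd _ _), ?_, ?_⟩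
    · apply CartesianMonoidalCategory.hom_ext <;> simp
    · apply CartesianMonoidalCategory.hom_ext <;> simp [h₂]
  · intro Z l l' h₁ h₂
    have h₃ := h₁ =≫ fst _ _
    have h₄ := h₂ =≫ fst _ _
    have h₅ := h₁ =≫ snd _ _
    simp only [Category.assoc, whiskerRight_fst, whiskerRight_snd] at h₃ h₄ h₅
    refine CartesianMonoidalCategory.hom_ext _ _ (h.hom_ext ?_ ?_) h₅
    · simpa using h₃
    · simpa using h₄

theorem isPullback_whisker_exchange {D E S T : C} (q : D ⟶ E) (h : S ⟶ T) :
    IsPullback (q ▷ S) (D ◁ h) (E ◁ h) (q ▷ T) := by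
  apply isPullback_of_existsUnique
  · rw [whisker_exchange]
  · intro Z x y hxy
    have h₁ := hxy =≫ fst _ _
    have h₂ := hxy =≫ snd _ _
    simp only [Category.assoc, whiskerRight_fst, whiskerRight_snd, whiskerLeft_fst,
      whiskerLeft_snd] at h₁ h₂
    refine ⟨lift (y ≫ fst _ _) (x ≫ snd _ _), ?_, ?_⟩
    · apply CartesianMonoidalCategory.hom_ext <;> simp [h₁]
    · apply CartesianMonoidalCategory.hom_ext <;> simp [h₂]
  · intro Z l l' h₁ h₂
    have h₄ := h₂ =≫ fst _ _
    have h₅ := h₁ =≫ snd _ _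
    simp only [Category.assoc, whiskerRight_snd, whiskerLeft_fst] at h₄ h₅
    exact CartesianMonoidalCategory.hom_ext _ _ h₄ h₅

end Cartesian

/-! ### Singletons, partial maps and pushouts of monomorphisms -/

section Pushout

variable [CartesianMonoidalCategory C] [HasSubobjectClassifier C]

theorem lift_self_comp_χ {T A : C} (c : T ⟶ A) :
    lift c c ≫ χ (lift (𝟙 A) (𝟙 A)) = Subobject.Classifier.χ₀ _ T ≫ truth C := by
  rw [← comp_comp_χ (m := lift (𝟙 A) (𝟙 A)) c, ← Category.assoc, comp_lift, Category.comp_id]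

theorem eq_of_lift_comp_χ {T A : C} {c d : T ⟶ A}
    (h : lift c d ≫ χ (lift (𝟙 A) (𝟙 A)) = Subobject.Classifier.χ₀ _ T ≫ truth C) : c = d := by
  obtain ⟨l, hl⟩ := exists_lift_of_comp_χ _ h
  rw [comp_lift, Category.comp_id] at hl
  rw [← lift_fst c d, ← hl, lift_fst, ← lift_snd c d, ← hl, lift_snd]

variable [MonoidalClosed C]

variable (C) in
/-- The object of subobjects of `A`. -/
abbrev power (A : C) : C := (ihom A).obj (Ω C)

/-- The singleton arrow of `A`. -/
def singleton (A : C) : A ⟶ power C A := curry (χ (lift (𝟙 A) (𝟙 A)))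

instance mono_singleton (A : C) : Mono (singleton A) where
  right_cancellation {T} c d h := by
    rw [singleton, ← curry_natural_left, ← curry_natural_left] at h
    -- Evaluated at the element `d`, equality of the singletons of `c` and `d` says that `d` lies in
    -- the singleton of `c`.
    have h' := lift d (𝟙 T) ≫= curry_injective h
    simp only [← Category.assoc, lift_whiskerLeft, Category.id_comp] at h'
    rw [lift_self_comp_χ] at h'
    exact (eq_of_lift_comp_χ h').symm

/-- The arrow `B ⟶ power A` of the partial map `f` from `B` to `A` with domain `m`. -/
def partialMap {Z B A : C} (m : Z ⟶ B) [Mono m] (f : Z ⟶ A) : B ⟶ power C A :=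
  curry (χ (lift f m))

/-- In terms of elements, `partialMap m f` sends `b` to the set of all `f z` with `m z = b`. If this
set is the singleton of `c`, then `c` belongs to it, so `(c, b)` lifts to `Z`. The power object thus
serves in place of a partial map classifier. -/
theorem isPullback_partialMap {Z B A : C} (m : Z ⟶ B) [Mono m] (f : Z ⟶ A) :
    IsPullback m f (partialMap m f) (singleton A) := by
  apply isPullback_of_existsUnique
  · rw [partialMap, singleton, ← curry_natural_left, ← curry_natural_left]
    -- Both transposes classify the graph of `f` in `A ⊗ Z`.
    have h₁ : IsPullback (lift f (𝟙 Z)) (𝟙 Z) (A ◁ m) (lift f m) := by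
      apply isPullback_of_existsUnique
      · apply CartesianMonoidalCategory.hom_ext <;> simp
      · intro T x y h
        have h₁ := h =≫ fst _ _
        have h₂ := h =≫ snd _ _
        simp only [Category.assoc, whiskerLeft_fst, whiskerLeft_snd, lift_fst, lift_snd] at h₁ h₂
        rw [← Category.assoc, cancel_mono] at h₂
        refine ⟨y, ?_, by simp⟩
        apply CartesianMonoidalCategory.hom_ext <;> simp [h₁, h₂]
      · intro T l l' _ h
        simpa using h
    have h₂ : IsPullback (lift f (𝟙 Z)) f (A ◁ f) (lift (𝟙 A) (𝟙 A)) := by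
      apply isPullback_of_existsUnique
      · apply CartesianMonoidalCategory.hom_ext <;> simp
      · intro T x y h
        have h₁ := h =≫ fst _ _
        have h₂ := h =≫ snd _ _
        simp only [Category.assoc, whiskerLeft_fst, whiskerLeft_snd, lift_fst, lift_snd,
          Category.comp_id] at h₁ h₂
        refine ⟨x ≫ snd _ _, ?_, by simp [h₂]⟩
        apply CartesianMonoidalCategory.hom_ext <;> simp [h₁, h₂]
      · intro T l l' h _
        simpa using h =≫ snd _ _
    rw [comp_χ h₁, comp_χ h₂]
  · intro T b c h
    rw [partialMap, singleton, ← curry_natural_left, ← curry_natural_left] at h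
    have h' := lift c (𝟙 T) ≫= curry_injective h
    simp only [← Category.assoc, lift_whiskerLeft, Category.id_comp] at h'
    rw [lift_self_comp_χ] at h'
    obtain ⟨l, hl⟩ := exists_lift_of_comp_χ _ h'
    exact ⟨l, by simpa using hl =≫ snd _ _, by simpa using hl =≫ fst _ _⟩
  · intro T l l' h _
    rwa [← cancel_mono m]

/-- The square of `isPullback_partialMap` is a cocone, so it induces an arrow from `D` to the power
object of `A`. Its composite with `j` is the singleton arrow, which forces `j` to be monic. Elements
of `B` and `A` identified in `D` are identified in the power object, where they lift to `Z`. -/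
theorem mono_and_isPullback_of_isPushout {Z B A D : C} {m : Z ⟶ B} {f : Z ⟶ A} {i : B ⟶ D}
    {j : A ⟶ D} [Mono m] (h : IsPushout m f i j) : Mono j ∧ IsPullback m f i j := by
  have hP := isPullback_partialMap m f
  have hj := h.inr_desc _ _ hP.w
  have hi := h.inl_desc _ _ hP.w
  refine ⟨mono_of_mono_fac hj, isPullback_of_existsUnique h.w (fun T b c hbc => ?_)
    (fun T l l' hl _ => by rwa [← cancel_mono m])⟩
  refine ⟨hP.lift b c ?_, hP.lift_fst _ _ _, hP.lift_snd _ _ _⟩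
  refine (b ≫= hi).symm.trans (Eq.trans ?_ (c ≫= hj))
  rw [← Category.assoc, ← Category.assoc, hbc]

end Pushout

/-! ### Monadicity of the power functor and existence of pushouts -/

section Monadicity

variable [CartesianMonoidalCategory C] [MonoidalClosed C] [HasSubobjectClassifier C]

/-- Inverse image along an arrow. -/
def powerMap {A B : C} (f : A ⟶ B) : power C B ⟶ power C A := (pre f).app (Ω C)

theorem uncurry_comp_powerMap {A B T : C} (f : A ⟶ B) (g : T ⟶ power C B) :
    uncurry (g ≫ powerMap f) = f ▷ T ≫ uncurry g :=
  uncurry_pre_app (f := g) (g := f)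

theorem powerMap_id (A : C) : powerMap (𝟙 A) = 𝟙 (power C A) := by
  rw [powerMap, pre_id, NatTrans.id_app]

theorem powerMap_comp {A B D : C} (f : A ⟶ B) (g : B ⟶ D) :
    powerMap (f ≫ g) = powerMap g ≫ powerMap f := by
  rw [powerMap, pre_map, NatTrans.comp_app, powerMap, powerMap]

variable (C) in
/-- The contravariant power functor. -/
def powerFunctor : Cᵒᵖ ⥤ C where
  obj A := power C (unop A)
  map f := powerMap f.unop
  map_id A := powerMap_id (unop A)
  map_comp f g := powerMap_comp g.unop f.unop

/-- Transposition of binary relations. -/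
def transpose {A B : C} (f : A ⟶ power C B) : B ⟶ power C A :=
  curry (lift (snd A B) (fst A B) ≫ uncurry f)

theorem transpose_transpose {A B : C} (f : A ⟶ power C B) : transpose (transpose f) = f := by
  rw [transpose, transpose, uncurry_curry, ← Category.assoc, comp_lift, lift_fst, lift_snd,
    lift_fst_snd, Category.id_comp, curry_uncurry]

theorem transpose_comp {A A' B : C} (h : A' ⟶ A) (f : A ⟶ power C B) :
    transpose (h ≫ f) = transpose f ≫ powerMap h := by
  apply uncurry_injective
  rw [uncurry_comp_powerMap]
  simp only [transpose, uncurry_curry, uncurry_natural_left]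
  simp only [← Category.assoc]
  congr 1
  apply CartesianMonoidalCategory.hom_ext <;> simp

variable (C) in
/-- The power functor is right adjoint to its opposite. -/
def powerAdjunction : (powerFunctor C).rightOp ⊣ powerFunctor C :=
  Adjunction.mkOfHomEquiv
    { homEquiv := fun _ _ =>
        { toFun := fun f => transpose f.unop
          invFun := fun f => Quiver.Hom.op (transpose f)
          left_inv := fun f => congrArg Quiver.Hom.op (transpose_transpose f.unop)
          right_inv := fun f => transpose_transpose f }
      homEquiv_naturality_left_symm := fun f g => congrArg Quiver.Hom.op (transpose_comp f g)
      homEquiv_naturality_right := fun f g => transpose_comp g.unop f.unop }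

/-- Inverse images of singletons recover the relation `f a = b`. On the graph of `g` it reads `f a =
g a`, while the corresponding relation for `g` is true there. -/
theorem powerMap_injective {A B : C} {f g : A ⟶ B} (h : powerMap f = powerMap g) : f = g := by
  have h' := congrArg uncurry (singleton B ≫= h)
  rw [uncurry_comp_powerMap, uncurry_comp_powerMap, singleton, uncurry_curry] at h'
  have h₂ := lift (𝟙 A) g ≫= h'
  simp only [← Category.assoc, lift_whiskerRight, Category.id_comp] at h₂
  rw [lift_self_comp_χ] at h₂
  exact eq_of_lift_comp_χ h₂

instance : (powerFunctor C).Faithful where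
  map_injective h := Quiver.Hom.unop_inj (powerMap_injective h)

variable [HasFiniteLimits C]

variable (C) in
/-- The membership relation of `A`. -/
abbrev mem (A : C) : C := pullback ((ihom.ev A).app (Ω C)) (truth C)

/-- The inclusion of the membership relation. -/
abbrev memι (A : C) : mem C A ⟶ A ⊗ power C A := pullback.fst _ _

theorem χ_memι (A : C) : χ (memι A) = (ihom.ev A).app (Ω C) :=
  (unique _ _ (by
    have h := IsPullback.of_hasPullback ((ihom.ev A).app (Ω C)) (truth C)
    rwa [Subsingleton.elim (pullback.snd _ _) (Subobject.Classifier.χ₀ _ _)] at h)).symm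

/-- Direct image along a monomorphism. -/
def directImage {A B : C} (m : A ⟶ B) [Mono m] : power C A ⟶ power C B :=
  curry (χ (memι A ≫ m ▷ power C A))

theorem directImage_id (A : C) : directImage (𝟙 A) = 𝟙 (power C A) := by
  apply uncurry_injective
  have h : memι A ≫ 𝟙 A ▷ power C A = memι A := by simp
  rw [directImage, uncurry_curry, uncurry_id_eq_ev, ← χ_memι]
  congr 1

/-- The Beck–Chevalley condition for direct images along monomorphisms. -/
theorem directImage_comp_map {D A B E : C} {p : D ⟶ A} {q : D ⟶ E} {m : A ⟶ B} {f : E ⟶ B}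
    [Mono m] [Mono q] (h : IsPullback q p f m) :
    directImage m ≫ powerMap f = powerMap p ≫ directImage q := by
  apply uncurry_injective
  rw [uncurry_comp_powerMap, uncurry_natural_left, directImage, uncurry_curry, directImage,
    uncurry_curry]
  set k := powerMap p with hk
  have h₀ := IsPullback.of_hasPullback (p ▷ power C A) (memι A)
  have h₁ := h₀.paste_horiz (isPullback_whiskerRight h (power C A))
  -- Both arrows are the transpose of `powerMap p`. Hence the membership relation of `A` pulled back
  -- along `p` is also that of `D` pulled back along `k`. Included through `q`, this one subobject
  -- of `E ⊗ power C A` is classified by both sides of the goal.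
  have hw : D ◁ k ≫ χ (memι D) = p ▷ power C A ≫ χ (memι A) := by
    rw [χ_memι, χ_memι, ← uncurry_id_eq_ev A, ← uncurry_comp_powerMap, Category.id_comp,
      uncurry_eq]
  have h₂ : IsPullback (pullback.fst (p ▷ power C A) (memι A))
      (Subobject.Classifier.χ₀ _ _) (D ◁ k ≫ χ (memι D)) (truth C) := by
    have := h₀.paste_vert (isPullback_χ (memι A))
    rwa [hw, Subsingleton.elim (Subobject.Classifier.χ₀ _ _) (pullback.snd (p ▷ power C A) (memι A)
      ≫ Subobject.Classifier.χ₀ _ _)]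
  have h₃ := IsPullback.of_bot' h₂ (isPullback_χ (memι D))
  have h₄ := h₃.paste_horiz (isPullback_whisker_exchange q k)
  rw [comp_χ h₁, comp_χ h₄]

/-- The power functor turns the equalizer of a coreflexive pair into a split coequalizer. -/
def powerSplitCoequalizer {E A B : C} {e : E ⟶ A} {f g : A ⟶ B} {s : B ⟶ A} (hf : f ≫ s = 𝟙 A)
    (hg : g ≫ s = 𝟙 A) [Mono e] (w : e ≫ f = e ≫ g)
    (h : ∀ {T : C} (k : T ⟶ A), k ≫ f = k ≫ g → ∃ l : T ⟶ E, l ≫ e = k) :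
    IsSplitCoequalizer (powerMap f) (powerMap g) (powerMap e) :=
  haveI : Mono f := mono_of_mono_fac hf
  haveI : Mono g := mono_of_mono_fac hg
  { rightSection := directImage e
    leftSection := directImage g
    condition := by rw [← powerMap_comp, w, powerMap_comp]
    rightSection_π := by
      rw [directImage_comp_map (IsKernelPair.id_of_mono e), powerMap_id, Category.id_comp,
        directImage_id]
    leftSection_bottom := by
      rw [directImage_comp_map (IsKernelPair.id_of_mono g), powerMap_id, Category.id_comp,
        directImage_id]
    -- The common retraction `s` turns `x ≫ f = y ≫ g` into `x = y`. The equalizer is therefore the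
    -- pullback of `f` and `g`, and Beck–Chevalley applies to this square.
    leftSection_top := directImage_comp_map (isPullback_of_existsUnique w
      (fun T x y hxy => by
        have hxy' : x = y := by simpa [hf, hg] using hxy =≫ s
        subst hxy'
        obtain ⟨l, hl⟩ := h x hxy
        exact ⟨l, hl, hl⟩)
      (fun T l l' hl _ => by rwa [← cancel_mono e])) }

/-- A reflexive pair in `Cᵒᵖ` is a coreflexive pair in `C`, and its coequalizer is an equalizer in
`C`. Split coequalizers are coequalizers. -/
instance : Monad.PreservesColimitOfIsReflexivePair (powerFunctor C) where
  out {A B} f g _ := by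
    obtain ⟨s, hf, hg⟩ := IsReflexivePair.common_section f g
    have hc := coequalizerIsCoequalizer f g
    have : Mono (coequalizer.π f g).unop := inferInstance
    have t := powerSplitCoequalizer (e := (coequalizer.π f g).unop) (f := f.unop) (g := g.unop)
      (s := s.unop) (congrArg Quiver.Hom.unop hf) (congrArg Quiver.Hom.unop hg)
      (congrArg Quiver.Hom.unop (coequalizer.condition f g))
      (fun k hk => ⟨(coequalizer.desc k.op (congrArg Quiver.Hom.op hk)).unop,
        congrArg Quiver.Hom.unop (coequalizer.π_desc k.op (congrArg Quiver.Hom.op hk))⟩)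
    exact preservesColimit_of_preserves_colimit_cocone hc
      ((isColimitMapCoconeCoforkEquiv _ _).symm t.isCoequalizer)

variable (C) in
/-- An elementary topos has pushouts. -/
theorem hasPushouts : HasPushouts C := by
  -- Crude monadicity: reflexive coequalizers in `Cᵒᵖ` are equalizers in `C`, and faithfulness
  -- together with balancedness makes the functor reflect isomorphisms.
  let _ : MonadicRightAdjoint (powerFunctor C) :=
    Monad.monadicOfHasPreservesReflexiveCoequalizersOfReflectsIsomorphisms (powerAdjunction C)
  have : HasLimitsOfShape WalkingCospan Cᵒᵖ :=
    let _ : CreatesLimitsOfSize.{0, 0} (powerFunctor C) := monadicCreatesLimits (powerFunctor C)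
    hasLimitsOfShape_of_hasLimitsOfShape_createsLimitsOfShape (powerFunctor C)
  have : HasPushouts Cᵒᵖᵒᵖ := inferInstance
  exact Adjunction.hasColimitsOfShape_of_equivalence (opOpEquivalence C).inverse

end Monadicity

end

end CategoryTheory.ElementaryTopos

/-! ### Pushouts and intersections of subobjects -/

namespace CategoryTheory.ElementaryTopos

theorem mono_fst_of_isPullback {C : Type u₁} [Category.{v₁} C] {P X Y Z : C} {fst : P ⟶ X}
    {snd : P ⟶ Y} {f : X ⟶ Z} {g : Y ⟶ Z} [Mono g] (h : IsPullback fst snd f g) : Mono fst where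
  right_cancellation l l' hl := h.hom_ext hl (by
    rw [← cancel_mono g, Category.assoc, Category.assoc, ← h.w, reassoc_of% hl])

/-- The intersection of two inverse images is the inverse image of the intersection. -/
theorem isPullback_intersection {C : Type u₁} [Category.{v₁} C] {x D P Q w y W I : C} {a : x ⟶ D}
    {p : P ⟶ D} {q : Q ⟶ D} {i : w ⟶ x} {j : y ⟶ x} {a₁ : w ⟶ P} {a₂ : y ⟶ Q} {π₁ : W ⟶ w}
    {π₂ : W ⟶ y} {ρ₁ : I ⟶ P} {ρ₂ : I ⟶ Q} [Mono i] [Mono j] (hI : IsPullback ρ₁ ρ₂ p q)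
    (h₁ : IsPullback i a₁ a p) (h₂ : IsPullback j a₂ a q) (hW : IsPullback π₁ π₂ i j) {l : W ⟶ I}
    (hl₁ : l ≫ ρ₁ = π₁ ≫ a₁) (hl₂ : l ≫ ρ₂ = π₂ ≫ a₂) :
    IsPullback (π₁ ≫ i) l a (ρ₁ ≫ p) := by
  apply isPullback_of_existsUnique
  · rw [reassoc_of% hl₁, Category.assoc, h₁.w]
  · intro T s r h
    have h₃ : s ≫ a = (r ≫ ρ₁) ≫ p := by rw [h, Category.assoc]
    have h₄ : s ≫ a = (r ≫ ρ₂) ≫ q := by rw [h, Category.assoc, hI.w]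
    have h₅ : h₁.lift s (r ≫ ρ₁) h₃ ≫ i = h₂.lift s (r ≫ ρ₂) h₄ ≫ j := by
      rw [h₁.lift_fst, h₂.lift_fst]
    refine ⟨hW.lift _ _ h₅, ?_, hI.hom_ext ?_ ?_⟩
    · rw [← Category.assoc, hW.lift_fst, h₁.lift_fst]
    · rw [Category.assoc, hl₁, ← Category.assoc, hW.lift_fst, h₁.lift_snd]
    · rw [Category.assoc, hl₂, ← Category.assoc, hW.lift_snd, h₂.lift_snd]
  · intro T l₁ l₂ h _
    have h₃ : l₁ ≫ π₁ = l₂ ≫ π₁ := by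
      rwa [← cancel_mono i, Category.assoc, Category.assoc]
    refine hW.hom_ext h₃ ?_
    rw [← cancel_mono j, Category.assoc, Category.assoc, ← hW.w, ← Category.assoc, h₃,
      Category.assoc]

section PushoutMap

variable {C : Type u₁} [Category.{v₁} C] [CartesianMonoidalCategory C] [MonoidalClosed C]
  [HasSubobjectClassifier C]

/-- Enlarging one of the two objects in a pushout along a monomorphism. -/
theorem mono_and_isPullback_of_isPushout_left {Z Z' x y w D D' : C} {f : Z ⟶ x} {g : Z ⟶ y}
    {a : x ⟶ D} {b : y ⟶ D} {f' : Z' ⟶ w} {g' : Z' ⟶ y} {a' : w ⟶ D'} {b' : y ⟶ D'}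
    (h : IsPushout f g a b) (h' : IsPushout f' g' a' b') {i : w ⟶ x} [Mono i] (z : Z' ⟶ Z)
    [IsIso z] (hf : f' ≫ i = z ≫ f) (hg : g' = z ≫ g) {k : D' ⟶ D}
    (hl : a' ≫ k = i ≫ a) (hr : b' ≫ k = b) :
    Mono k ∧ IsPullback i a' a k := by
  -- By pasting, the square on `i` and `k` is itself a pushout, now along the monomorphism `i`.
  have h₂ : IsPushout (f' ≫ i) g' a b :=
    h.of_iso (asIso z).symm (Iso.refl _) (Iso.refl _) (Iso.refl _)
      (by simp [hf]) (by simp [hg]) (by simp) (by simp)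
  exact mono_and_isPullback_of_isPushout (IsPushout.of_left (by rwa [hr]) hl.symm h')

variable [HasPushouts C] {Z Z' x y w v D D' : C} {f : Z ⟶ x} {g : Z ⟶ y}
    {a : x ⟶ D} {b : y ⟶ D} {f' : Z' ⟶ w} {g' : Z' ⟶ v} {a' : w ⟶ D'} {b' : v ⟶ D'}

/-- Enlarging both objects in a pushout along monomorphisms. -/
theorem mono_and_isPullback_of_isPushout_map
    (h : IsPushout f g a b) (h' : IsPushout f' g' a' b') {i : w ⟶ x} {j : v ⟶ y} [Mono i] [Mono j]
    (z : Z' ⟶ Z) [IsIso z] (hf : f' ≫ i = z ≫ f) (hg : g' ≫ j = z ≫ g) {k : D' ⟶ D}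
    (hl : a' ≫ k = i ≫ a) (hr : b' ≫ k = j ≫ b) :
    Mono k ∧ IsPullback i a' a k := by
  -- The intermediate pushout of `x` and `v`: passing to it enlarges only `w`, and passing on to `D`
  -- enlarges only `v`.
  have hP := IsPushout.of_hasPushout f (inv z ≫ g')
  have w₁ : f' ≫ i ≫ pushout.inl f (inv z ≫ g') = g' ≫ pushout.inr f (inv z ≫ g') := by
    rw [reassoc_of% hf, pushout.condition]
    simp
  have w₂ : f ≫ a = (inv z ≫ g') ≫ j ≫ b := by
    rw [Category.assoc, reassoc_of% hg, IsIso.inv_hom_id_assoc, h.w]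
  obtain ⟨m₁, p₁⟩ := mono_and_isPullback_of_isPushout_left hP h' z hf (by simp)
    (h'.inl_desc _ _ w₁) (h'.inr_desc _ _ w₁)
  obtain ⟨m₂, -⟩ := mono_and_isPullback_of_isPushout_left h.flip hP.flip (𝟙 Z)
    (by rw [Category.assoc, hg]; simp) (by simp) (hP.inr_desc _ _ w₂) (hP.inl_desc _ _ w₂)
  have hk : k = h'.desc _ _ w₁ ≫ hP.desc _ _ w₂ := by
    apply h'.hom_ext
    · rw [hl, h'.inl_desc_assoc, Category.assoc, hP.inl_desc]
    · rw [hr, h'.inr_desc_assoc, hP.inr_desc]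
  refine ⟨hk ▸ mono_comp _ _, isPullback_of_existsUnique hl.symm (fun T s t hst => ?_)
    (fun T l l' hl _ => by rwa [← cancel_mono i])⟩
  -- The second enlargement is monic, so the equation in `D` already holds in the intermediate
  -- pushout, where the first pullback provides the lift.
  have hst' : s ≫ pushout.inl f (inv z ≫ g') = t ≫ h'.desc _ _ w₁ := by
    rw [← cancel_mono (hP.desc _ _ w₂), Category.assoc, Category.assoc, hP.inl_desc, hst, hk]
  exact ⟨p₁.lift _ _ hst', p₁.lift_fst _ _ _, p₁.lift_snd _ _ _⟩

/-- The pushout of intersections is the intersection of the pushouts. -/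
theorem isIso_of_isPushout_intersection {Z₁ Z₂ Z₃ w₁ v₁ w₂ v₂ w₃ v₃ D₁ D₂ D₃ I : C}
    (h : IsPushout f g a b)
    {f₁ : Z₁ ⟶ w₁} {g₁ : Z₁ ⟶ v₁} {a₁ : w₁ ⟶ D₁} {b₁ : v₁ ⟶ D₁} (h₁ : IsPushout f₁ g₁ a₁ b₁)
    {i₁ : w₁ ⟶ x} {j₁ : v₁ ⟶ y} [Mono i₁] [Mono j₁] (z₁ : Z₁ ⟶ Z) [IsIso z₁]
    (hf₁ : f₁ ≫ i₁ = z₁ ≫ f) (hg₁ : g₁ ≫ j₁ = z₁ ≫ g) {k₁ : D₁ ⟶ D} (hl₁ : a₁ ≫ k₁ = i₁ ≫ a)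
    (hr₁ : b₁ ≫ k₁ = j₁ ≫ b)
    {f₂ : Z₂ ⟶ w₂} {g₂ : Z₂ ⟶ v₂} {a₂ : w₂ ⟶ D₂} {b₂ : v₂ ⟶ D₂} (h₂ : IsPushout f₂ g₂ a₂ b₂)
    {i₂ : w₂ ⟶ x} {j₂ : v₂ ⟶ y} [Mono i₂] [Mono j₂] (z₂ : Z₂ ⟶ Z) [IsIso z₂]
    (hf₂ : f₂ ≫ i₂ = z₂ ≫ f) (hg₂ : g₂ ≫ j₂ = z₂ ≫ g) {k₂ : D₂ ⟶ D} (hl₂ : a₂ ≫ k₂ = i₂ ≫ a)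
    (hr₂ : b₂ ≫ k₂ = j₂ ≫ b)
    {f₃ : Z₃ ⟶ w₃} {g₃ : Z₃ ⟶ v₃} {a₃ : w₃ ⟶ D₃} {b₃ : v₃ ⟶ D₃} (h₃ : IsPushout f₃ g₃ a₃ b₃)
    {π₁ : w₃ ⟶ w₁} {π₂ : w₃ ⟶ w₂} (hw : IsPullback π₁ π₂ i₁ i₂)
    {σ₁ : v₃ ⟶ v₁} {σ₂ : v₃ ⟶ v₂} (hv : IsPullback σ₁ σ₂ j₁ j₂) (z₃ : Z₃ ⟶ Z) [IsIso z₃]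
    (hf₃ : f₃ ≫ π₁ ≫ i₁ = z₃ ≫ f) (hg₃ : g₃ ≫ σ₁ ≫ j₁ = z₃ ≫ g)
    {ρ₁ : I ⟶ D₁} {ρ₂ : I ⟶ D₂} (hI : IsPullback ρ₁ ρ₂ k₁ k₂) {θ : D₃ ⟶ I}
    (ha₁ : a₃ ≫ θ ≫ ρ₁ = π₁ ≫ a₁) (ha₂ : a₃ ≫ θ ≫ ρ₂ = π₂ ≫ a₂)
    (hb₁ : b₃ ≫ θ ≫ ρ₁ = σ₁ ≫ b₁) (hb₂ : b₃ ≫ θ ≫ ρ₂ = σ₂ ≫ b₂) : IsIso θ := by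
  obtain ⟨m₁, p₁⟩ := mono_and_isPullback_of_isPushout_map h h₁ z₁ hf₁ hg₁ hl₁ hr₁
  obtain ⟨m₂, p₂⟩ := mono_and_isPullback_of_isPushout_map h h₂ z₂ hf₂ hg₂ hl₂ hr₂
  have q₁ := (mono_and_isPullback_of_isPushout_map h.flip h₁.flip z₁ hg₁ hf₁ hr₁ hl₁).2
  have q₂ := (mono_and_isPullback_of_isPushout_map h.flip h₂.flip z₂ hg₂ hf₂ hr₂ hl₂).2
  have : Mono π₁ := mono_fst_of_isPullback hw
  have : Mono σ₁ := mono_fst_of_isPullback hv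
  have : Mono ρ₁ := mono_fst_of_isPullback hI
  have hl₃ : a₃ ≫ θ ≫ ρ₁ ≫ k₁ = (π₁ ≫ i₁) ≫ a := by
    rw [reassoc_of% ha₁, hl₁, Category.assoc]
  have hr₃ : b₃ ≫ θ ≫ ρ₁ ≫ k₁ = (σ₁ ≫ j₁) ≫ b := by
    rw [reassoc_of% hb₁, hr₁, Category.assoc]
  obtain ⟨m₃, p₃⟩ := mono_and_isPullback_of_isPushout_map h h₃ z₃ hf₃ hg₃ hl₃ hr₃
  have q₃ := (mono_and_isPullback_of_isPushout_map h.flip h₃.flip z₃ hg₃ hf₃ hr₃ hl₃).2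
  -- The intersection `I` restricts to `w₃` on `x` and to `v₃` on `y`, exactly as `D₃` does by `p₃`
  -- and `q₃`.
  have p₄ := isPullback_intersection hI p₁ p₂ hw (l := a₃ ≫ θ) (by rwa [Category.assoc])
    (by rwa [Category.assoc])
  have q₄ := isPullback_intersection hI q₁ q₂ hv (l := b₃ ≫ θ) (by rwa [Category.assoc])
    (by rwa [Category.assoc])
  obtain ⟨e, he⟩ := exists_iso_of_isPullback (fun _ _ => h.hom_ext) p₃ p₄ q₃ q₄
  have hθ : θ = e.hom := by
    rw [← cancel_mono (ρ₁ ≫ k₁), he]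
  rw [hθ]
  infer_instance

end PushoutMap

end CategoryTheory.ElementaryTopos

namespace FineRewriting

noncomputable section

/-! ### Spans of isomorphisms as isomorphisms -/

namespace IsoSpan

variable {A : Type u₁} [Category.{v₁} A]

/-- The isomorphism represented by a span of isomorphisms. -/
def toHom {a c : A} (s : IsoSpan a c) : a ⟶ c := inv s.fst ≫ s.snd

theorem fst_toHom {a c : A} (s : IsoSpan a c) : s.fst ≫ s.toHom = s.snd := by simp [toHom]

theorem toHom_eq_iff {a c : A} {s : IsoSpan a c} {f : a ⟶ c} : s.toHom = f ↔ s.snd = s.fst ≫ f := by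
  rw [toHom, IsIso.inv_comp_eq]

/-- A morphism of spans is forced by the first legs, and it respects the second legs exactly when
the represented arrows agree. Equivalences of spans thereby become equations in `A`. -/
theorem equiv_iff {a c : A} {s t : IsoSpan a c} : s ≈ t ↔ s.toHom = t.toHom := by
  rw [toHom_eq_iff]
  constructor
  · intro h
    rw [← transport_snd h, ← transport_fst s t, Category.assoc, fst_toHom]
  · intro h
    refine ⟨asIso s.fst ≪≫ (asIso t.fst).symm, by simp, ?_⟩
    rw [h, toHom]
    simp

theorem toHom_id (a : A) : (IsoSpan.id a).toHom = 𝟙 a := by simp [toHom_eq_iff]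

theorem toHom_comp [HasPullbacks A] {a b c : A} (s : IsoSpan a b) (t : IsoSpan b c) :
    (s.comp t).toHom = s.toHom ≫ t.toHom := by
  rw [toHom_eq_iff, comp_snd, comp_fst, Category.assoc, ← Category.assoc s.fst, fst_toHom,
    ← Category.assoc, comp_condition, Category.assoc, fst_toHom]

theorem id_comp_equiv [HasPullbacks A] {a b : A} (s : IsoSpan a b) : (IsoSpan.id a).comp s ≈ s := by
  rw [equiv_iff, toHom_comp, toHom_id, Category.id_comp]

theorem comp_id_equiv [HasPullbacks A] {a b : A} (s : IsoSpan a b) : s.comp (IsoSpan.id b) ≈ s := by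
  rw [equiv_iff, toHom_comp, toHom_id, Category.comp_id]

theorem comp_assoc_equiv [HasPullbacks A] {a b c d : A} (s : IsoSpan a b) (t : IsoSpan b c)
    (r : IsoSpan c d) : (s.comp t).comp r ≈ s.comp (t.comp r) := by
  simp only [equiv_iff, toHom_comp, Category.assoc]

theorem transport_self {a b : A} (s : IsoSpan a b) : s.transport s = 𝟙 _ := by
  simp [transport]

theorem compFst_transport [HasPullbacks A] {a b c : A} (s s' : IsoSpan a b) (t t' : IsoSpan b c) :
    compFst s t ≫ s.transport s' = (s.comp t).transport (s'.comp t') ≫ compFst s' t' := by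
  rw [← cancel_mono s'.fst, Category.assoc, Category.assoc, transport_fst, ← comp_fst, ← comp_fst,
    transport_fst]

/-- Unlike its counterpart for `compFst`, this needs the equivalences: `transport` is built from
first legs and respects second legs only between equivalent spans. -/
theorem compSnd_transport [HasPullbacks A] {a b c : A} {s s' : IsoSpan a b} {t t' : IsoSpan b c}
    (h : t ≈ t') (h' : s.comp t ≈ s'.comp t') :
    compSnd s t ≫ t.transport t' = (s.comp t).transport (s'.comp t') ≫ compSnd s' t' := by
  rw [← cancel_mono t'.snd, Category.assoc, Category.assoc, transport_snd h, ← comp_snd,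
    ← comp_snd, transport_snd h']

end IsoSpan

variable {A : Type u₁} [Category.{v₁} A] {X : Type u₂} [Category.{v₂} X] {L : A ⥤ X}

/-! ### Equivalence of fine spans and vertical composition -/

namespace FineSpan

section Basic

variable {a b c d : A} {m : StrCospan L a b} {n : StrCospan L c d}

/-- Equivalence of spans of structured cospans is detected on the middle object and the outer
spans. -/
theorem equiv_of_isIso {r s : FineSpan m n} (hl : r.left ≈ s.left) (hr : r.right ≈ s.right)
    (θ : r.mid.apex ⟶ s.mid.apex) [IsIso θ] (hu : θ ≫ s.up = r.up) (hd : θ ≫ s.down = r.down) :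
    r ≈ s := by
  obtain ⟨el, hl⟩ := hl
  obtain ⟨er, hr⟩ := hr
  refine ⟨el, er, asIso θ, hl, hr, hu, hd, ?_, ?_⟩
  -- Compatibility with the feet can be tested after the monic leg `s.up`, where it follows from the
  -- outer spans.
  · rw [← cancel_mono s.up, Category.assoc, asIso_hom, hu, Category.assoc, s.inl_up, r.inl_up,
      ← L.map_comp_assoc, hl.1]
  · rw [← cancel_mono s.up, Category.assoc, asIso_hom, hu, Category.assoc, s.inr_up, r.inr_up,
      ← L.map_comp_assoc, hr.1]

end Basic

theorem unit_id_equiv (a : A) : FineSpan.unit (L := L) (IsoSpan.id a) ≈ FineSpan.id _ :=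
  equiv_of_isIso (Setoid.refl _) (Setoid.refl _) (𝟙 _) (by simp) (by simp)

section Vertical

variable [HasPullbacks A] [HasPullbacks X] {a b c d a' b' c' d' : A} {m : StrCospan L a b}
  {n : StrCospan L c d} {p : StrCospan L a' b'} {o : StrCospan L c' d'}

theorem id_vComp_equiv (r : FineSpan m n) : (FineSpan.id m).vComp r ≈ r :=
  equiv_of_isIso (IsoSpan.id_comp_equiv _) (IsoSpan.id_comp_equiv _) (pullback.snd _ _)
    pullback.condition.symm rfl

theorem vComp_id_equiv (r : FineSpan m n) : r.vComp (FineSpan.id n) ≈ r :=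
  equiv_of_isIso (IsoSpan.comp_id_equiv _) (IsoSpan.comp_id_equiv _) (pullback.fst _ _)
    rfl pullback.condition

theorem vComp_assoc_equiv (r : FineSpan m n) (s : FineSpan n p) (t : FineSpan p o) :
    (r.vComp s).vComp t ≈ r.vComp (s.vComp t) :=
  equiv_of_isIso (IsoSpan.comp_assoc_equiv _ _ _) (IsoSpan.comp_assoc_equiv _ _ _)
    (pullbackAssoc r.down s.up s.down t.up).hom (by simp) (by simp)

theorem unit_comp_equiv {a b c : A} (s : IsoSpan a b) (t : IsoSpan b c) :
    FineSpan.unit (L := L) (s.comp t) ≈ (FineSpan.unit s).vComp (FineSpan.unit t) := by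
  have w : L.map (s.compFst t) ≫ L.map s.snd = L.map (s.compSnd t) ≫ L.map t.fst := by
    rw [← L.map_comp, ← L.map_comp, IsoSpan.comp_condition]
  have : IsIso (s.compFst t) := by rw [IsoSpan.compFst]; infer_instance
  have : IsIso (pullback.lift _ _ w ≫ pullback.fst _ _) := by
    rw [pullback.lift_fst]; infer_instance
  -- Projections of pullbacks of isomorphisms are invertible, so the comparison is invertible by
  -- two-out-of-three.
  have : IsIso (pullback.lift _ _ w) := IsIso.of_isIso_comp_right _ (pullback.fst _ _)
  refine equiv_of_isIso (Setoid.refl _) (Setoid.refl _) (pullback.lift _ _ w) ?_ ?_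
  · rw [pullback.lift_fst_assoc, ← L.map_comp]
    rfl
  · rw [pullback.lift_snd_assoc, ← L.map_comp]
    rfl

end Vertical

/-- The span `r` is globular, and it is the graph of `e`. -/
structure IsGraph {a b : A} {m n : StrCospan L a b} (r : FineSpan m n) (e : m.apex ⟶ n.apex) :
    Prop where
  left : r.left ≈ IsoSpan.id a
  right : r.right ≈ IsoSpan.id b
  isIso_up : IsIso r.up
  fac : r.up ≫ e = r.down

/-! ### Calculus of globular graphs -/

namespace IsGraph

variable {a b c : A} {m n p : StrCospan L a b}

/-- Since the upper leg is invertible, a graph is determined up to equivalence by its arrow.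
Pentagon and triangle thus reduce to equations in `X`. -/
theorem equiv {r s : FineSpan m n} {e : m.apex ⟶ n.apex} (hr : r.IsGraph e) (hs : s.IsGraph e) :
    r ≈ s :=
  haveI := hr.isIso_up
  haveI := hs.isIso_up
  equiv_of_isIso (Setoid.trans hr.left (Setoid.symm hs.left))
    (Setoid.trans hr.right (Setoid.symm hs.right)) (r.up ≫ inv s.up)
    (by simp) (by rw [← hr.fac, ← hs.fac]; simp)

theorem id (m : StrCospan L a b) : (FineSpan.id m).IsGraph (𝟙 m.apex) :=
  ⟨Setoid.refl _, Setoid.refl _, inferInstance, by simp⟩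

theorem ofIso (e : m.apex ≅ n.apex) (hl : m.inl ≫ e.hom = n.inl) (hr : m.inr ≫ e.hom = n.inr) :
    (FineSpan.ofIso e hl hr).IsGraph e.hom :=
  ⟨Setoid.refl _, Setoid.refl _, inferInstance, by simp⟩

theorem vComp [HasPullbacks A] [HasPullbacks X] {r : FineSpan m n} {s : FineSpan n p}
    {e : m.apex ⟶ n.apex} {f : n.apex ⟶ p.apex} (hr : r.IsGraph e) (hs : s.IsGraph f) :
    (r.vComp s).IsGraph (e ≫ f) := by
  have := hr.isIso_up
  have := hs.isIso_up
  refine ⟨?_, ?_, inferInstance, ?_⟩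
  · simp only [IsoSpan.equiv_iff, IsoSpan.toHom_comp, IsoSpan.equiv_iff.1 hr.left,
      IsoSpan.equiv_iff.1 hs.left, IsoSpan.toHom_id, Category.comp_id]
  · simp only [IsoSpan.equiv_iff, IsoSpan.toHom_comp, IsoSpan.equiv_iff.1 hr.right,
      IsoSpan.equiv_iff.1 hs.right, IsoSpan.toHom_id, Category.comp_id]
  · rw [Category.assoc, reassoc_of% hr.fac, pullback.condition_assoc, hs.fac]

theorem hComp [HasPushouts X] (H : HorizontalCompositesFine L) {m' n' : StrCospan L b c}
    {r : FineSpan m n} {s : FineSpan m' n'} {e : m.apex ⟶ n.apex} {f : m'.apex ⟶ n'.apex}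
    (hr : r.IsGraph e) (hs : s.IsGraph f) (h : r.right ≈ s.left)
    {k : pushout m.inr m'.inl ⟶ pushout n.inr n'.inl}
    (hl : pushout.inl m.inr m'.inl ≫ k = e ≫ pushout.inl n.inr n'.inl)
    (hk : pushout.inr m.inr m'.inl ≫ k = f ≫ pushout.inr n.inr n'.inl) :
    (FineSpan.hComp H r s h).IsGraph k := by
  have := hr.isIso_up
  have := hs.isIso_up
  refine ⟨hr.left, hs.right, ?_, ?_⟩
  · exact pushout.map_isIso _ _ m.inr m'.inl r.up s.up (L.map r.right.fst) r.inr_up (by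
      rw [Category.assoc, s.inl_up, ← L.map_comp_assoc, IsoSpan.transport_fst])
  · apply pushout.hom_ext
    · rw [reassoc_of% inl_hUp, inl_hDown, hl, reassoc_of% hr.fac]
    · rw [reassoc_of% inr_hUp, inr_hDown, hk, reassoc_of% hs.fac]

end IsGraph

/-- A square of spans of structured cospans, two opposite sides of which are graphs of
isomorphisms, commutes up to equivalence if the middle objects are compatibly isomorphic. -/
theorem vComp_equiv_of_isGraph [HasPullbacks A] [HasPullbacks X] {a b c d : A}
    {m m' : StrCospan L a b} {n n' : StrCospan L c d} {q : FineSpan m n} {q' : FineSpan m' n'}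
    {r : FineSpan m m'} {s : FineSpan n n'} {e : m.apex ⟶ m'.apex} {f : n.apex ⟶ n'.apex} [IsIso e]
    (hr : r.IsGraph e) (hs : s.IsGraph f) (hl : q.left ≈ q'.left) (hr' : q.right ≈ q'.right)
    (φ : q.mid.apex ⟶ q'.mid.apex) [IsIso φ] (hu : φ ≫ q'.up = q.up ≫ e)
    (hd : φ ≫ q'.down = q.down ≫ f) : q.vComp s ≈ r.vComp q' := by
  have := hr.isIso_up
  have := hs.isIso_up
  have : IsIso r.down := by rw [← hr.fac]; infer_instance
  -- Both projections are base changes of the isomorphisms `s.up` and `r.down`, so each composite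
  -- has the middle object of its non-graph factor.
  refine equiv_of_isIso ?_ ?_ (pullback.fst _ _ ≫ φ ≫ inv (pullback.snd r.down q'.up)) ?_ ?_
  · simp only [IsoSpan.equiv_iff, IsoSpan.toHom_comp, IsoSpan.equiv_iff.1 hr.left,
      IsoSpan.equiv_iff.1 hs.left, IsoSpan.equiv_iff.1 hl, IsoSpan.toHom_id, Category.comp_id,
      Category.id_comp]
  · simp only [IsoSpan.equiv_iff, IsoSpan.toHom_comp, IsoSpan.equiv_iff.1 hr.right,
      IsoSpan.equiv_iff.1 hs.right, IsoSpan.equiv_iff.1 hr', IsoSpan.toHom_id, Category.comp_id,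
      Category.id_comp]
  · rw [← cancel_mono e]
    simp only [Category.assoc, hr.fac, ← hu]
    rw [pullback.condition, IsIso.inv_hom_id_assoc]
  · simp only [Category.assoc, IsIso.inv_hom_id_assoc, hd]
    rw [pullback.condition_assoc, hs.fac]

theorem ofIso_vComp_symm [HasPullbacks A] [HasPullbacks X] {a b : A} {m n : StrCospan L a b} (e : m.apex ≅ n.apex)
    (hl : m.inl ≫ e.hom = n.inl) (hr : m.inr ≫ e.hom = n.inr) (hl' : n.inl ≫ e.inv = m.inl)
    (hr' : n.inr ≫ e.inv = m.inr) :
    (FineSpan.ofIso e hl hr).vComp (FineSpan.ofIso e.symm hl' hr') ≈ FineSpan.id m :=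
  ((IsGraph.ofIso e hl hr).vComp (IsGraph.ofIso e.symm hl' hr')).equiv (by
    simpa using IsGraph.id m)

/-! ### Coherence and naturality for horizontal composition -/

section Horizontal

attribute [local simp] pushout.inl_desc pushout.inl_desc_assoc pushout.inr_desc
  pushout.inr_desc_assoc

variable [HasPushouts X] (H : HorizontalCompositesFine L)

theorem isGraph_assocSpan {a b c d : A} (m : StrCospan L a b) (n : StrCospan L b c)
    (p : StrCospan L c d) :
    (assocSpan m n p).IsGraph (pushoutAssoc m.inr n.inl n.inr p.inl).hom := by
  unfold assocSpan
  exact IsGraph.ofIso _ _ _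

theorem isGraph_leftUnitorSpan {a b : A} (m : StrCospan L a b) :
    (leftUnitorSpan m).IsGraph (pushoutIdLeft m.inl).hom := by
  unfold leftUnitorSpan
  exact IsGraph.ofIso _ _ _

theorem isGraph_rightUnitorSpan {a b : A} (m : StrCospan L a b) :
    (rightUnitorSpan m).IsGraph (pushoutIdRight m.inr).hom := by
  unfold rightUnitorSpan
  exact IsGraph.ofIso _ _ _

theorem hComp_id_equiv {a b c : A} (m : StrCospan L a b) (m' : StrCospan L b c)
    (h : (FineSpan.id m).right ≈ (FineSpan.id m').left) :
    hComp H (FineSpan.id m) (FineSpan.id m') h ≈ FineSpan.id (m.comp m') :=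
  (IsGraph.hComp H (IsGraph.id m) (IsGraph.id m') h (by simp) (by simp)).equiv (IsGraph.id _)

theorem inl_pushoutIdLeft {z x : X} (f : z ⟶ x) :
    pushout.inl (𝟙 z) f ≫ (pushoutIdLeft f).hom = f := pushout.inl_desc _ _ _

theorem inr_pushoutIdLeft {z x : X} (f : z ⟶ x) :
    pushout.inr (𝟙 z) f ≫ (pushoutIdLeft f).hom = 𝟙 x := pushout.inr_desc _ _ _

theorem inl_pushoutIdRight {z x : X} (f : z ⟶ x) :
    pushout.inl f (𝟙 z) ≫ (pushoutIdRight f).hom = 𝟙 x := pushout.inl_desc _ _ _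

theorem inr_pushoutIdRight {z x : X} (f : z ⟶ x) :
    pushout.inr f (𝟙 z) ≫ (pushoutIdRight f).hom = f := pushout.inr_desc _ _ _

variable [HasPullbacks A] [HasPullbacks X]

theorem triangle_equiv {a b c : A} (m : StrCospan L a b) (n : StrCospan L b c)
    (h₁ : (FineSpan.id m).right ≈ (leftUnitorSpan n).left)
    (h₂ : (rightUnitorSpan m).right ≈ (FineSpan.id n).left) :
    (assocSpan m (StrCospan.unit b) n).vComp (hComp H (FineSpan.id m) (leftUnitorSpan n) h₁) ≈
      hComp H (rightUnitorSpan m) (FineSpan.id n) h₂ := by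
  refine ((isGraph_assocSpan _ _ _).vComp (IsGraph.hComp H (IsGraph.id m)
    (isGraph_leftUnitorSpan n) h₁ (k := pushout.map _ _ _ _ (𝟙 _) (pushoutIdLeft n.inl).hom (𝟙 _)
    (by simp) (by rw [Category.assoc, inl_pushoutIdLeft])) (by simp) (by simp))).equiv ?_
  refine IsGraph.hComp H (isGraph_rightUnitorSpan m) (IsGraph.id n) h₂ ?_ ?_
  · apply pushout.hom_ext
    · simp [reassoc_of% inl_pushoutIdRight]
    · simp [reassoc_of% inr_pushoutIdRight, reassoc_of% inl_pushoutIdLeft, pushout.condition]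
  · simp [reassoc_of% inr_pushoutIdLeft]

theorem pentagon_equiv {a b c d e : A} (m : StrCospan L a b) (n : StrCospan L b c)
    (p : StrCospan L c d) (o : StrCospan L d e)
    (h₁ : (assocSpan m n p).right ≈ (FineSpan.id o).left)
    (h₂ : (FineSpan.id m).right ≈ (assocSpan n p o).left) :
    ((hComp H (assocSpan m n p) (FineSpan.id o) h₁).vComp (assocSpan m (n.comp p) o)).vComp
        (hComp H (FineSpan.id m) (assocSpan n p o) h₂) ≈
      (assocSpan (m.comp n) p o).vComp (assocSpan m n (p.comp o)) := by
  refine ((((isGraph_assocSpan m n p).hComp H (IsGraph.id o) h₁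
    (k := pushout.map _ _ _ _ (pushoutAssoc m.inr n.inl n.inr p.inl).hom (𝟙 _) (𝟙 _)
      (by simp) (by simp)) (by simp) (by simp)).vComp
    (isGraph_assocSpan _ _ _)).vComp ((IsGraph.id m).hComp H (isGraph_assocSpan n p o) h₂
    (k := pushout.map _ _ _ _ (𝟙 _) (pushoutAssoc n.inr p.inl p.inr o.inl).hom (𝟙 _)
      (by simp) (by simp)) (by simp) (by simp))).equiv ?_
  convert (isGraph_assocSpan (m.comp n) p o).vComp (isGraph_assocSpan m n (p.comp o)) using 1
  apply pushout.hom_ext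
  · apply pushout.hom_ext
    · apply pushout.hom_ext <;> simp
    · simp
  · simp

theorem leftUnitor_natural_equiv {a b c d : A} {m : StrCospan L a b} {n : StrCospan L c d}
    (q : FineSpan m n) (h : (FineSpan.unit (L := L) q.left).right ≈ q.left) :
    (hComp H (FineSpan.unit q.left) q h).vComp (leftUnitorSpan n) ≈
      (leftUnitorSpan m).vComp q := by
  refine vComp_equiv_of_isGraph (isGraph_leftUnitorSpan m) (isGraph_leftUnitorSpan n)
    (Setoid.refl _) (Setoid.refl _) (pushoutIdLeft _).hom ?_ ?_
  · apply pushout.hom_ext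
    · rw [reassoc_of% inl_pushoutIdLeft, reassoc_of% inl_hUp, inl_pushoutIdLeft, Category.assoc, q.inl_up,
        ← L.map_comp_assoc, IsoSpan.transport_fst]
    · rw [reassoc_of% inr_pushoutIdLeft, reassoc_of% inr_hUp, inr_pushoutIdLeft, Category.comp_id]
  · apply pushout.hom_ext
    · rw [reassoc_of% inl_pushoutIdLeft, reassoc_of% inl_hDown, inl_pushoutIdLeft,
        Category.assoc, q.inl_down,
        ← L.map_comp_assoc, IsoSpan.transport_snd h]
    · rw [reassoc_of% inr_pushoutIdLeft, reassoc_of% inr_hDown, inr_pushoutIdLeft,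
        Category.comp_id]

theorem rightUnitor_natural_equiv {a b c d : A} {m : StrCospan L a b} {n : StrCospan L c d}
    (q : FineSpan m n) (h : q.right ≈ (FineSpan.unit (L := L) q.right).left) :
    (hComp H q (FineSpan.unit q.right) h).vComp (rightUnitorSpan n) ≈
      (rightUnitorSpan m).vComp q := by
  -- Gluing inserts a transport, here from a span to itself; it must be removed before the second
  -- leg becomes an identity.
  have w : L.map (q.right.transport q.right) ≫ 𝟙 _ = 𝟙 _ := by
    rw [IsoSpan.transport_self, L.map_id, Category.id_comp]
  let φ : pushout q.mid.inr (L.map (q.right.transport q.right) ≫ 𝟙 _) ≅ q.mid.apex :=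
    pushout.congrHom rfl w ≪≫ pushoutIdRight q.mid.inr
  have hl : pushout.inl _ _ ≫ φ.hom = 𝟙 _ := by simp [φ, inl_pushoutIdRight]
  have hr : pushout.inr _ _ ≫ φ.hom = q.mid.inr := by simp [φ, inr_pushoutIdRight]
  refine vComp_equiv_of_isGraph (isGraph_rightUnitorSpan m) (isGraph_rightUnitorSpan n)
    (Setoid.refl _) (Setoid.refl _) φ.hom ?_ ?_
  · apply pushout.hom_ext
    · rw [reassoc_of% hl, reassoc_of% inl_hUp, inl_pushoutIdRight, Category.comp_id]
    · rw [reassoc_of% hr, reassoc_of% inr_hUp, inr_pushoutIdRight, q.inr_up]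
  · apply pushout.hom_ext
    · rw [reassoc_of% hl, reassoc_of% inl_hDown, inl_pushoutIdRight, Category.comp_id]
    · rw [reassoc_of% hr, reassoc_of% inr_hDown, inr_pushoutIdRight, q.inr_down]

theorem assoc_natural_equiv {a b c d a' b' c' d' : A} {m : StrCospan L a b} {n : StrCospan L b c}
    {p : StrCospan L c d} {m' : StrCospan L a' b'} {n' : StrCospan L b' c'}
    {p' : StrCospan L c' d'} (q : FineSpan m m') (r : FineSpan n n') (s : FineSpan p p')
    (h₁ : q.right ≈ r.left) (h₂ : (hComp H q r h₁).right ≈ s.left) (h₃ : r.right ≈ s.left)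
    (h₄ : q.right ≈ (hComp H r s h₃).left) :
    (hComp H (hComp H q r h₁) s h₂).vComp (assocSpan m' n' p') ≈
      (assocSpan m n p).vComp (hComp H q (hComp H r s h₃) h₄) := by
  -- The associator of the middle rows; `congrHom` only rebrackets the gluing arrow.
  let φ := pushoutAssoc q.mid.inr (L.map (q.right.transport r.left) ≫ r.mid.inl) r.mid.inr
      (L.map (r.right.transport s.left) ≫ s.mid.inl) ≪≫ pushout.congrHom rfl (Category.assoc _ _ _)
  have hφ₁ : pushout.inl _ _ ≫ pushout.inl _ _ ≫ φ.hom = pushout.inl _ _ := by simp [φ]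
  have hφ₂ : pushout.inr _ _ ≫ pushout.inl _ _ ≫ φ.hom = pushout.inl _ _ ≫ pushout.inr _ _ := by
    simp [φ]
  have hφ₃ : pushout.inr _ _ ≫ φ.hom = pushout.inr _ _ ≫ pushout.inr _ _ := by simp [φ]
  refine vComp_equiv_of_isGraph (isGraph_assocSpan m n p) (isGraph_assocSpan m' n' p')
    (Setoid.refl _) (Setoid.refl _) φ.hom ?_ ?_
  · have e₁ : pushout.inl
        (r.mid.inr ≫ pushout.inr q.mid.inr (L.map (q.right.transport r.left) ≫ r.mid.inl))
        (L.map (r.right.transport s.left) ≫ s.mid.inl) ≫ (hComp H q r h₁).hUp s =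
        hUp q r ≫ pushout.inl _ _ := inl_hUp (hComp H q r h₁) s
    have e₂ : pushout.inr
        (r.mid.inr ≫ pushout.inr q.mid.inr (L.map (q.right.transport r.left) ≫ r.mid.inl))
        (L.map (r.right.transport s.left) ≫ s.mid.inl) ≫ (hComp H q r h₁).hUp s =
        s.up ≫ pushout.inr _ _ := inr_hUp (hComp H q r h₁) s
    have e₃ : pushout.inl q.mid.inr (L.map (q.right.transport r.left) ≫ r.mid.inl ≫ pushout.inl _ _) ≫
        q.hUp (hComp H r s h₃) = q.up ≫ pushout.inl _ _ :=
      inl_hUp q (hComp H r s h₃)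
    have e₄ : pushout.inr q.mid.inr (L.map (q.right.transport r.left) ≫ r.mid.inl ≫ pushout.inl _ _) ≫
        q.hUp (hComp H r s h₃) = hUp r s ≫ pushout.inr _ _ :=
      inr_hUp q (hComp H r s h₃)
    apply pushout.hom_ext
    · apply pushout.hom_ext
      · rw [reassoc_of% hφ₁, e₃, reassoc_of% e₁, reassoc_of% inl_hUp q r, inl_inl_pushoutAssoc_hom]
      · rw [reassoc_of% hφ₂, e₄, reassoc_of% e₁, reassoc_of% inr_hUp q r, reassoc_of% inl_hUp r s,
          inr_inl_pushoutAssoc_hom]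
    · rw [reassoc_of% hφ₃, e₄, reassoc_of% e₂, reassoc_of% inr_hUp r s, inr_pushoutAssoc_hom]
  · have e₁ : pushout.inl
        (r.mid.inr ≫ pushout.inr q.mid.inr (L.map (q.right.transport r.left) ≫ r.mid.inl))
        (L.map (r.right.transport s.left) ≫ s.mid.inl) ≫ (hComp H q r h₁).hDown s h₂ =
        hDown q r h₁ ≫ pushout.inl _ _ :=
      inl_hDown (hComp H q r h₁) s h₂
    have e₂ : pushout.inr
        (r.mid.inr ≫ pushout.inr q.mid.inr (L.map (q.right.transport r.left) ≫ r.mid.inl))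
        (L.map (r.right.transport s.left) ≫ s.mid.inl) ≫ (hComp H q r h₁).hDown s h₂ =
        s.down ≫ pushout.inr _ _ := inr_hDown (hComp H q r h₁) s h₂
    have e₃ : pushout.inl q.mid.inr (L.map (q.right.transport r.left) ≫ r.mid.inl ≫ pushout.inl _ _) ≫
        q.hDown (hComp H r s h₃) h₄ = q.down ≫ pushout.inl _ _ :=
      inl_hDown q (hComp H r s h₃) h₄
    have e₄ : pushout.inr q.mid.inr (L.map (q.right.transport r.left) ≫ r.mid.inl ≫ pushout.inl _ _) ≫
        q.hDown (hComp H r s h₃) h₄ = hDown r s h₃ ≫ pushout.inr _ _ :=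
      inr_hDown q (hComp H r s h₃) h₄
    apply pushout.hom_ext
    · apply pushout.hom_ext
      · rw [reassoc_of% hφ₁, e₃, reassoc_of% e₁, reassoc_of% inl_hDown q r, inl_inl_pushoutAssoc_hom]
      · rw [reassoc_of% hφ₂, e₄, reassoc_of% e₁, reassoc_of% inr_hDown q r, reassoc_of% inl_hDown r s,
          inr_inl_pushoutAssoc_hom]
    · rw [reassoc_of% hφ₃, e₄, reassoc_of% e₂, reassoc_of% inr_hDown r s, inr_pushoutAssoc_hom]

end Horizontal

end FineSpan

end

end FineRewriting

namespace FineRewriting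

variable {A : Type u₁} [Category.{v₁} A] {X : Type u₂} [Category.{v₂} X] {L : A ⥤ X}

/-! ### Monicity of horizontal composites and interchange -/

section Topos

open CategoryTheory.ElementaryTopos FineSpan

variable [HasPushouts X] [CartesianMonoidalCategory X] [MonoidalClosed X]
  [HasSubobjectClassifier X]

/-- The arrow between the glued feet is the image under `L` of a leg of `r.right`, hence invertible.
-/
theorem horizontalCompositesFine : HorizontalCompositesFine L := by
  intro a b c a' b' c' m n m' n' r s h
  refine ⟨(mono_and_isPullback_of_isPushout_map (IsPushout.of_hasPushout _ _)
      (IsPushout.of_hasPushout _ _) (L.map r.right.fst) r.inr_up ?_ (inl_hUp r s)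
      (inr_hUp r s)).1,
    (mono_and_isPullback_of_isPushout_map (IsPushout.of_hasPushout _ _)
      (IsPushout.of_hasPushout _ _) (L.map r.right.snd) r.inr_down ?_ (inl_hDown r s h)
      (inr_hDown r s h)).1⟩
  · rw [Category.assoc, s.inl_up, ← L.map_comp_assoc, IsoSpan.transport_fst]
  · rw [Category.assoc, s.inl_down, ← L.map_comp_assoc, IsoSpan.transport_snd h]

variable [HasPullbacks A] [HasPullbacks X]

theorem FineSpan.interchange_equiv (H : HorizontalCompositesFine L) {a b c a' b' c' a'' b'' c'' : A}
    {m : StrCospan L a b} {m' : StrCospan L b c} {n : StrCospan L a' b'} {n' : StrCospan L b' c'}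
    {p : StrCospan L a'' b''} {p' : StrCospan L b'' c''} (q : FineSpan m n) (q' : FineSpan m' n')
    (r : FineSpan n p) (r' : FineSpan n' p') (hq : q.right ≈ q'.left) (hr : r.right ≈ r'.left)
    (h : (q.vComp r).right ≈ (q'.vComp r').left) :
    (hComp H q q' hq).vComp (hComp H r r' hr) ≈ hComp H (q.vComp r) (q'.vComp r') h := by
  -- `w₁` and `w₂` project the pushout of the two pullbacks onto the two horizontal composites; by
  -- `w` they agree in the pushout of `n` and `n'`.
  have w₁ : (vMid q r).inr ≫ pullback.fst q.down r.up ≫ pushout.inl q.mid.inr _ =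
      (L.map ((q.vComp r).right.transport (q'.vComp r').left) ≫ (vMid q' r').inl) ≫
        pullback.fst q'.down r'.up ≫
          pushout.inr q.mid.inr (L.map (q.right.transport q'.left) ≫ q'.mid.inl) := by
    rw [pullback.lift_fst_assoc, Category.assoc, Category.assoc, pullback.lift_fst_assoc,
      Category.assoc, ← L.map_comp_assoc, ← IsoSpan.compFst_transport, pushout.condition,
      L.map_comp_assoc, Category.assoc]
  have w₂ : (vMid q r).inr ≫ pullback.snd q.down r.up ≫ pushout.inl r.mid.inr _ =
      (L.map ((q.vComp r).right.transport (q'.vComp r').left) ≫ (vMid q' r').inl) ≫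
        pullback.snd q'.down r'.up ≫
          pushout.inr r.mid.inr (L.map (r.right.transport r'.left) ≫ r'.mid.inl) := by
    rw [pullback.lift_snd_assoc, Category.assoc, Category.assoc, pullback.lift_snd_assoc,
      Category.assoc, ← L.map_comp_assoc, ← IsoSpan.compSnd_transport hr h, pushout.condition,
      L.map_comp_assoc, Category.assoc]
  have w : pushout.desc _ _ w₁ ≫ hDown q q' hq = pushout.desc _ _ w₂ ≫ hUp r r' := by
    apply pushout.hom_ext
    · rw [pushout.inl_desc_assoc, Category.assoc, inl_hDown, pushout.inl_desc_assoc,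
        Category.assoc, inl_hUp, pullback.condition_assoc]
    · rw [pushout.inr_desc_assoc, Category.assoc, inr_hDown, pushout.inr_desc_assoc,
        Category.assoc, inr_hUp, pullback.condition_assoc]
  have : IsIso (IsoSpan.compFst q.right r.right) := by rw [IsoSpan.compFst]; infer_instance
  -- The ambient object is the pushout of `n` and `n'`. The subobjects being intersected come from
  -- the lower legs of `q`, `q'` and the upper legs of `r`, `r'`.
  have : IsIso (pullback.lift _ _ w) := by
    refine isIso_of_isPushout_intersection (IsPushout.of_hasPushout n.inr n'.inl)
      (IsPushout.of_hasPushout q.mid.inr (L.map (q.right.transport q'.left) ≫ q'.mid.inl))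
      (L.map q.right.snd) q.inr_down ?_ (inl_hDown q q' hq) (inr_hDown q q' hq)
      (IsPushout.of_hasPushout r.mid.inr (L.map (r.right.transport r'.left) ≫ r'.mid.inl))
      (L.map r.right.fst) r.inr_up ?_ (inl_hUp r r') (inr_hUp r r')
      (IsPushout.of_hasPushout (vMid q r).inr
        (L.map ((q.vComp r).right.transport (q'.vComp r').left) ≫ (vMid q' r').inl))
      (IsPullback.of_hasPullback q.down r.up) (IsPullback.of_hasPullback q'.down r'.up)
      (L.map (IsoSpan.compFst q.right r.right ≫ q.right.snd)) ?_ ?_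
      (IsPullback.of_hasPullback (hDown q q' hq) (hUp r r')) ?_ ?_ ?_ ?_
    · rw [Category.assoc, q'.inl_down, ← L.map_comp_assoc, IsoSpan.transport_snd hq]
    · rw [Category.assoc, r'.inl_up, ← L.map_comp_assoc, IsoSpan.transport_fst]
    · rw [pullback.lift_fst_assoc, Category.assoc, q.inr_down, L.map_comp_assoc]
    · rw [Category.assoc, pullback.lift_fst_assoc, Category.assoc, q'.inl_down,
        ← L.map_comp_assoc, ← L.map_comp_assoc, ← IsoSpan.compFst_transport, Category.assoc,
        IsoSpan.transport_snd hq]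
    · rw [pullback.lift_fst, pushout.inl_desc]
    · rw [pullback.lift_snd, pushout.inl_desc]
    · rw [pullback.lift_fst, pushout.inr_desc]
    · rw [pullback.lift_snd, pushout.inr_desc]
  refine Setoid.symm (equiv_of_isIso (Setoid.refl _) (Setoid.refl _) (pullback.lift _ _ w) ?_ ?_)
  · apply pushout.hom_ext
    · rw [pullback.lift_fst_assoc, pushout.inl_desc_assoc, inl_hUp, Category.assoc, inl_hUp,
        Category.assoc]
    · rw [pullback.lift_fst_assoc, pushout.inr_desc_assoc, inr_hUp, Category.assoc, inr_hUp,
        Category.assoc]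
  · apply pushout.hom_ext
    · rw [pullback.lift_snd_assoc, pushout.inl_desc_assoc, inl_hDown, Category.assoc, inl_hDown,
        Category.assoc]
    · rw [pullback.lift_snd_assoc, pushout.inr_desc_assoc, inr_hDown, Category.assoc, inr_hDown,
        Category.assoc]

end Topos

end FineRewriting

/-! ### Isomorphism classes and the pseudo double category -/

namespace FineRewriting

open FineSpan

section

variable {A : Type u₁} [Category.{v₁} A] {X : Type u₂} [Category.{v₂} X] {L : A ⥤ X}
  [HasPullbacks A] [HasPullbacks X] [HasPushouts X]  (H : HorizontalCompositesFine L)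

theorem ofIso_isInvertible {a b : A} {m n : StrCospan L a b} (e : m.apex ≅ n.apex)
    (hl : m.inl ≫ e.hom = n.inl) (hr : m.inr ≫ e.hom = n.inr) :
    (fineRewriteData L H).IsInvertible (m := m) (n := n) (Quotient.mk _ (FineSpan.ofIso e hl hr)) :=
  have hl' : n.inl ≫ e.inv = m.inl := by rw [Iso.comp_inv_eq, hl]
  have hr' : n.inr ≫ e.inv = m.inr := by rw [Iso.comp_inv_eq, hr]
  ⟨Quotient.mk _ (FineSpan.ofIso e.symm hl' hr'),
    Quotient.sound (ofIso_vComp_symm e hl hr hl' hr'),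
    Quotient.sound (ofIso_vComp_symm e.symm hl' hr' hl hr)⟩

theorem assocSpan_isInvertible {a b c d : A} (m : StrCospan L a b) (n : StrCospan L b c)
    (p : StrCospan L c d) :
    (fineRewriteData L H).IsInvertible (m := (m.comp n).comp p) (n := m.comp (n.comp p))
      (Quotient.mk _ (assocSpan m n p)) := by
  unfold assocSpan
  exact ofIso_isInvertible H _ _ _

theorem leftUnitorSpan_isInvertible {a b : A} (m : StrCospan L a b) :
    (fineRewriteData L H).IsInvertible (m := (StrCospan.unit a).comp m) (n := m)
      (Quotient.mk _ (leftUnitorSpan m)) := by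
  unfold leftUnitorSpan
  exact ofIso_isInvertible H _ _ _

theorem rightUnitorSpan_isInvertible {a b : A} (m : StrCospan L a b) :
    (fineRewriteData L H).IsInvertible (m := m.comp (StrCospan.unit b)) (n := m)
      (Quotient.mk _ (rightUnitorSpan m)) := by
  unfold rightUnitorSpan
  exact ofIso_isInvertible H _ _ _

end

/-- Each law is checked on representatives. `Quotient.exact` turns a shared edge into an equivalence
of spans, and the laws for outer edges mostly hold by definition on representatives. -/
theorem isPseudoDoubleCategory_fineRewriteData {A : Type u₁} [Category.{v₁} A] {X : Type u₂}
    [Category.{v₂} X] {L : A ⥤ X} [HasPullbacks A] [HasPullbacks X] [HasPushouts X]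
    [CartesianMonoidalCategory X] [MonoidalClosed X] [HasSubobjectClassifier X]
    (H : HorizontalCompositesFine L) : IsPseudoDoubleCategory (fineRewriteData L H) where
  ver_id_comp f := Quotient.inductionOn f fun s => Quotient.sound (IsoSpan.id_comp_equiv s)
  ver_comp_id f := Quotient.inductionOn f fun s => Quotient.sound (IsoSpan.comp_id_equiv s)
  ver_assoc f g h := Quotient.inductionOn₃ f g h fun r s t =>
    Quotient.sound (IsoSpan.comp_assoc_equiv r s t)
  sq_id_comp q := Quotient.inductionOn q fun r => Quotient.sound (id_vComp_equiv r)
  sq_comp_id q := Quotient.inductionOn q fun r => Quotient.sound (vComp_id_equiv r)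
  sq_assoc q r s := Quotient.inductionOn₃ q r s fun q r s =>
    Quotient.sound (vComp_assoc_equiv q r s)
  left_id _ := rfl
  right_id _ := rfl
  left_comp q r := Quotient.inductionOn₂ q r fun _ _ => rfl
  right_comp q r := Quotient.inductionOn₂ q r fun _ _ => rfl
  unit_id a := Quotient.sound (@unit_id_equiv A _ X _ L a)
  unit_comp f g := Quotient.inductionOn₂ f g fun s t => Quotient.sound (unit_comp_equiv s t)
  left_unit f := Quotient.inductionOn f fun _ => rfl
  right_unit f := Quotient.inductionOn f fun _ => rfl
  left_horComp q q' := Quotient.inductionOn₂ q q' fun _ _ _ => rfl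
  right_horComp q q' := Quotient.inductionOn₂ q q' fun _ _ _ => rfl
  horComp_id m m' h := Quotient.sound (hComp_id_equiv H m m' (Quotient.exact h))
  interchange q q' r r' := Quotient.inductionOn₂ q q' fun q q' =>
    Quotient.inductionOn₂ r r' fun r r' hq hr h => Quotient.sound
      (interchange_equiv H q q' r r' (Quotient.exact hq) (Quotient.exact hr) (Quotient.exact h))
  assoc_invertible m n p := assocSpan_isInvertible H m n p
  left_assoc _ _ _ := rfl
  right_assoc _ _ _ := rfl
  leftUnitor_invertible m := leftUnitorSpan_isInvertible H m
  left_leftUnitor _ := rfl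
  right_leftUnitor _ := rfl
  rightUnitor_invertible m := rightUnitorSpan_isInvertible H m
  left_rightUnitor _ := rfl
  right_rightUnitor _ := rfl
  assoc_natural q r s := Quotient.inductionOn₃ q r s fun q r s h₁ h₂ h₃ h₄ => Quotient.sound
    (assoc_natural_equiv H q r s (Quotient.exact h₁) (Quotient.exact h₂) (Quotient.exact h₃)
      (Quotient.exact h₄))
  leftUnitor_natural q := Quotient.inductionOn q fun q h => Quotient.sound
    (leftUnitor_natural_equiv H q (Quotient.exact h))
  rightUnitor_natural q := Quotient.inductionOn q fun q h => Quotient.sound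
    (rightUnitor_natural_equiv H q (Quotient.exact h))
  pentagon m n p o h₁ h₂ := Quotient.sound
    (pentagon_equiv H m n p o (Quotient.exact h₁) (Quotient.exact h₂))
  triangle m n h₁ h₂ := Quotient.sound
    (triangle_equiv H m n (Quotient.exact h₁) (Quotient.exact h₂))

end FineRewriting

theorem mainTheorem4 {A : Type u₁} [Category.{v₁} A] {X : Type u₂} [Category.{v₂} X]
    [HasFiniteLimits A] [CartesianMonoidalCategory A] [MonoidalClosed A]
    [HasSubobjectClassifier A]
    [HasFiniteLimits X] [CartesianMonoidalCategory X] [MonoidalClosed X]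
    [HasSubobjectClassifier X]
    (L : A ⥤ X) (R : X ⥤ A) (adj : L ⊣ R) [PreservesLimitsOfShape WalkingCospan L] :
    ∃ (_ : HasPushouts X) (H : FineRewriting.HorizontalCompositesFine L),
      IsPseudoDoubleCategory (FineRewriting.fineRewriteData L H) :=
  have := ElementaryTopos.hasPushouts X
  ⟨this, FineRewriting.horizontalCompositesFine,
    FineRewriting.isPseudoDoubleCategory_fineRewriteData _⟩
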